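/- Let $n\ge 2$, $\alpha\ge 0$, $\sigma>0$, and write $x=(x',x_n)$ for points of $\mathbb R^n$, with $x'=(x_1,\dots,x_{n-1})$. Subscripts of functions denote partial derivatives. For all real $M_1,M_2$ there is a constant $C=C(n,\alpha,\sigma,M_1,M_2)$ with the following property. Let $\Omega\subset\mathbb R^n$ be a bounded open convex set and let $u\in C^4(\Omega)\cap C(\overline\Omega)$ be a convex function which is strictly increasing in the $e_n$ direction in $\Omega$, with $$u=\sigma x_n\quad\text{on }\partial\Omega,\qquad u_n^{\alpha}\,\det D^2u=f(x_2,\dots,x_{n-1},u)\quad\text{in }\Omega,$$ where $f$ is a function with $f(x_2,\dots,x_{n-1},u(x))>0$ for $x\in\Omega$ (if $n=2$, $f$ depends on $u$ only). Let $v(x',s)$ be the graph function, in the $-e_n$ direction, of the level set $\{u=s\}$ in $\Omega$, that is, $v(x',u(x))=-x_n$ for $x=(x',x_n)\in\Omega$, equivalently $u(x',-v(x',s))=s$. Assume that $u_n(x)\le M_1$ and $|v_1(x',u(x))|\le M_2$ for all $x\in\Omega$. Then $v$ is of class $C^4$ near $(x',u(x))$ for every $x\in\Omega$, and $$v_{11}(x',u(x))\,|u(x)-\sigma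 x_n|\le C\qquad\text{for all }x\in\Omega.$$ In particular $C$ does not depend on $f$ or $\Omega$. -/

import Mathlib

namespace LevelSetEstimate

noncomputable section

/-- The partial derivative `∂g/∂xᵢ` at `x`. -/
def partialDeriv {n : ℕ} (i : Fin n) (g : EuclideanSpace ℝ (Fin n) → ℝ)
    (x : EuclideanSpace ℝ (Fin n)) : ℝ :=
  lineDeriv ℝ g x (EuclideanSpace.single i 1)

/-- The Hessian matrix `D²g(x)`. -/
def hessian {n : ℕ} (g : EuclideanSpace ℝ (Fin n) → ℝ) (x : EuclideanSpace ℝ (Fin n)) :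
    Matrix (Fin n) (Fin n) ℝ :=
  Matrix.of fun i j => partialDeriv i (partialDeriv j g) x

/-- For `x = (x', xₙ)`, the point `(x', s)`. -/
def setLast {k : ℕ} (x : EuclideanSpace ℝ (Fin (k + 1))) (s : ℝ) :
    EuclideanSpace ℝ (Fin (k + 1)) :=
  WithLp.toLp 2 (Function.update x.ofLp (Fin.last k) s)

/-- `g` is strictly increasing in the direction of the last coordinate vector on `Ω`. -/
def IncreasingInLast {k : ℕ} (Ω : Set (EuclideanSpace ℝ (Fin (k + 1))))
    (g : EuclideanSpace ℝ (Fin (k + 1)) → ℝ) : Prop :=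
  ∀ x ∈ Ω, ∀ t, x (Fin.last k) < t → setLast x t ∈ Ω → g x < g (setLast x t)

/-- The middle coordinates `(x₂, …, xₙ₋₁)` of `x ∈ ℝⁿ`, `n = m + 2`. -/
def middle {m : ℕ} (x : EuclideanSpace ℝ (Fin (m + 2))) : Fin m → ℝ :=
  fun i => x i.succ.castSucc

/-- The graph function `v(x', s)` in the direction `-eₙ` of the level set `{u = s}` in `Ω`, so that
`u (x', -v(x', s)) = s`. The argument `y` stands for `(x', s)`. If `u` is strictly increasing in the
last variable, the set below is a singleton for `y` of the form `(x', u(x))`, `x ∈ Ω`,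
and empty for all other `y`. -/
def levelGraph {k : ℕ} (Ω : Set (EuclideanSpace ℝ (Fin (k + 1))))
    (u : EuclideanSpace ℝ (Fin (k + 1)) → ℝ) (y : EuclideanSpace ℝ (Fin (k + 1))) : ℝ :=
  -sInf {t : ℝ | setLast y t ∈ Ω ∧ u (setLast y t) = y (Fin.last k)}

end

end LevelSetEstimate

/-
The graph function `v` of the level sets solves `det D²v = f (-vₙ) ^ β`, `β = n + 2 + α`, and `f`,
being independent of `x₁`, disappears when the logarithm of this equation is differentiated along
`e₁`. In the variables `(x', s)` the function `σ xₙ - u` is `w = -s - σ v`, which vanishes on the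
boundary. At a maximum of Pogorelov's function `w v₁₁ exp (γ v₁² / 2)`, choose a frame with first
vector parallel to `e₁` in which `D²v` is the identity. In the sum of the second order conditions
along the frame, the equation differentiated twice trades fourth derivatives of `v` for third ones,
and these are absorbed by the first order conditions, one of them in the direction `eₙ`, because
`β > n - 1`. What is left is a quadratic inequality for `w v₁₁`, controlled by `-1 / vₙ = uₙ ≤ M₁`
and `|v₁| ≤ M₂` once `γ` is small.
-/

open Filter Topology Matrix

namespace LevelSetEstimate

section LocalMaxima

theorem hasDerivAt_div_self {p p' : ℝ → ℝ} {p'' t : ℝ} (h : HasDerivAt p (p' t) t)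
    (h' : HasDerivAt p' p'' t) (h0 : p t ≠ 0) :
    HasDerivAt (fun s => p' s / p s) (p'' / p t - (p' t / p t) ^ 2) t :=
  (h'.div h h0).congr_deriv (by field_simp)

theorem second_deriv_nonpos_of_isLocalMax {φ φ' : ℝ → ℝ} {c t : ℝ} (hmax : IsLocalMax φ t)
    (h : ∀ᶠ s in 𝓝 t, HasDerivAt φ (φ' s) s) (h' : HasDerivAt φ' c t) : c ≤ 0 := by
  by_contra! hc
  have deriv_eq : deriv φ =ᶠ[𝓝 t] φ' := h.mono fun s hs => hs.deriv
  have second_deriv_eq : deriv (deriv φ) t = c := by rw [deriv_eq.deriv_eq, h'.deriv]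
  have hmin : IsLocalMin φ t := isLocalMin_of_deriv_deriv_pos (by rwa [second_deriv_eq])
    hmax.deriv_eq_zero h.self_of_nhds.continuousAt
  have constant : φ =ᶠ[𝓝 t] fun _ => φ t := by
    filter_upwards [hmax, hmin] with s h₁ h₂ using le_antisymm h₁ h₂
  have : deriv (deriv φ) t = 0 := by simpa using constant.deriv.deriv_eq
  linarith

theorem isLocalMax_log_add_log_add {X : Type*} [TopologicalSpace X] {w g r : X → ℝ} {x : X}
    (hw : ContinuousAt w x) (hg : ContinuousAt g x) (hw0 : 0 < w x) (hg0 : 0 < g x)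
    (hmax : IsLocalMax (fun y => w y * (g y * Real.exp (r y))) x) :
    IsLocalMax (fun y => Real.log (w y) + Real.log (g y) + r y) x := by
  have log_eq {y : X} (hw : 0 < w y) (hg : 0 < g y) :
      Real.log (w y * (g y * Real.exp (r y))) = Real.log (w y) + Real.log (g y) + r y := by
    rw [Real.log_mul hw.ne' (mul_pos hg (Real.exp_pos _)).ne',
      Real.log_mul hg.ne' (Real.exp_pos _).ne', Real.log_exp, ← add_assoc]
  filter_upwards [hmax, hw.eventually (lt_mem_nhds hw0), hg.eventually (lt_mem_nhds hg0)]
    with y hy hwy hgy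
  rw [← log_eq hwy hgy, ← log_eq hw0 hg0]
  exact Real.log_le_log (mul_pos hwy (mul_pos hgy (Real.exp_pos _))) hy

end LocalMaxima

section MatrixCalculus

variable {ι : Type*} {M M' : ℝ → Matrix ι ι ℝ} {A : Matrix ι ι ℝ} {t : ℝ}

theorem hasDerivAt_matrix_iff [Finite ι] :
    HasDerivAt M A t ↔ ∀ i j, HasDerivAt (fun s => M s i j) (A i j) t :=
  have := Fintype.ofFinite ι
  hasDerivAt_pi.trans (forall_congr' fun _ => hasDerivAt_pi)

variable [Fintype ι] [DecidableEq ι]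

theorem hasDerivAt_det (h : HasDerivAt M A t) :
    HasDerivAt (fun s => (M s).det) ((M t).adjugate * A).trace t := by
  have expansion : ((M t).adjugate * A).trace =
      ∑ σ : Equiv.Perm ι, ((Equiv.Perm.sign σ : ℤ) : ℝ) *
        ∑ i, (∏ j ∈ Finset.univ.erase i, M t (σ j) j) • A (σ i) i := by
    have diag_eq_det i : ((M t).adjugate * A) i i = ((M t).updateCol i (A.col i)).det := by
      rw [← cramer_apply, cramer_eq_adjugate_mulVec]
      rfl
    simp_rw [trace, diag_apply, diag_eq_det, det_apply', Finset.mul_sum]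
    rw [Finset.sum_comm]
    refine Finset.sum_congr rfl fun σ _ => Finset.sum_congr rfl fun i _ => ?_
    rw [← Finset.prod_erase_mul _ _ (Finset.mem_univ i), updateCol_self, smul_eq_mul]
    congr 2
    exact Finset.prod_congr rfl fun j hj => updateCol_ne (Finset.ne_of_mem_erase hj)
  simp_rw [expansion, det_apply']
  exact HasDerivAt.fun_sum fun σ _ => (HasDerivAt.fun_finsetProd fun i _ =>
    hasDerivAt_matrix_iff.1 h (σ i) i).const_mul _

theorem hasDerivAt_log_det (h : HasDerivAt M A t) (hdet : (M t).det ≠ 0) :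
    HasDerivAt (fun s => Real.log (M s).det) ((M t)⁻¹ * A).trace t := by
  convert (hasDerivAt_det h).log hdet using 1
  rw [inv_def, Ring.inverse_eq_inv', smul_mul, trace_smul, smul_eq_mul, inv_mul_eq_div]

open scoped Matrix.Norms.Operator in
theorem hasDerivAt_inv_matrix (h : HasDerivAt M A t) (hdet : (M t).det ≠ 0) :
    HasDerivAt (fun s => (M s)⁻¹) (-((M t)⁻¹ * A * (M t)⁻¹)) t := by
  obtain ⟨U, hU⟩ := (isUnit_iff_isUnit_det (M t)).2 hdet.isUnit
  have inv_at : HasFDerivAt Ring.inverse _ (M t) := hU ▸ hasFDerivAt_ringInverse (𝕜 := ℝ) U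
  have inv_eq : (M t)⁻¹ = ↑U⁻¹ := by rw [← hU, coe_units_inv]
  simp only [nonsing_inv_eq_ringInverse]
  exact (inv_at.comp_hasDerivAt t h).congr_deriv (by simp [← nonsing_inv_eq_ringInverse, inv_eq])

open scoped Matrix.Norms.Operator in
theorem hasDerivAt_trace_inv_mul (h : HasDerivAt M (M' t) t) (h' : HasDerivAt M' A t)
    (hdet : (M t).det ≠ 0) :
    HasDerivAt (fun s => ((M s)⁻¹ * M' s).trace)
      (((M t)⁻¹ * A).trace - ((M t)⁻¹ * M' t * ((M t)⁻¹ * M' t)).trace) t := by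
  have product_rule : HasDerivAt (fun s => (M s)⁻¹ * M' s) _ t :=
    (hasDerivAt_inv_matrix h hdet).mul h'
  refine (HasDerivAt.fun_sum fun i _ => hasDerivAt_matrix_iff.1 product_rule i i).congr_deriv ?_
  change trace _ = _
  rw [trace_add, neg_mul, trace_neg, Matrix.mul_assoc, Matrix.mul_assoc, neg_add_eq_sub,
    ← Matrix.mul_assoc]

theorem trace_of_log_det_eq {p p' : ℝ → ℝ} {p'' β c : ℝ} (h1 : M t = 1)
    (hM : ∀ᶠ s in 𝓝 t, HasDerivAt M (M' s) s) (hM' : HasDerivAt M' A t)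
    (hp : ∀ᶠ s in 𝓝 t, HasDerivAt p (p' s) s) (hp' : HasDerivAt p' p'' t) (hp0 : p t ≠ 0)
    (hdet : ∀ᶠ s in 𝓝 t, Real.log (M s).det = c + β * Real.log (p s)) :
    (M' t).trace = β * (p' t / p t) ∧
      A.trace = (M' t * M' t).trace + β * (p'' / p t - (p' t / p t) ^ 2) := by
  have det_ne : (M t).det ≠ 0 := by simp [h1]
  have first_order : (fun s => ((M s)⁻¹ * M' s).trace) =ᶠ[𝓝 t] fun s => β * (p' s / p s) := by
    have hdet_ne : ∀ᶠ s in 𝓝 t, (M s).det ≠ 0 :=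
      (hasDerivAt_det hM.self_of_nhds).continuousAt.eventually_ne det_ne
    filter_upwards [hM, hp, hdet_ne, hp.self_of_nhds.continuousAt.eventually_ne hp0,
      hdet.eventually_nhds] with s hMs hps hdet_s hp_s heq
    exact (hasDerivAt_log_det hMs hdet_s).unique
      ((((hps.log hp_s).const_mul β).const_add c).congr_of_eventuallyEq heq)
  have second_order := (hasDerivAt_trace_inv_mul hM.self_of_nhds hM' det_ne).unique
    (((hasDerivAt_div_self hp.self_of_nhds hp' hp0).const_mul β).congr_of_eventuallyEq first_order)
  have first_order_at := first_order.self_of_nhds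
  simp only [h1, inv_one, Matrix.one_mul] at first_order_at second_order
  exact ⟨first_order_at, by linarith⟩

end MatrixCalculus

section Congruence

variable {ι : Type*} [Fintype ι] [DecidableEq ι]

theorem exists_mem_orthogonalGroup_col_eq {w : ι → ℝ} (hw : w ⬝ᵥ w = 1) (i₀ : ι) :
    ∃ O ∈ orthogonalGroup ι ℝ, O.col i₀ = w := by
  have orthonormal : Orthonormal ℝ (({i₀} : Set ι).domRestrict fun _ => WithLp.toLp 2 w) := by
    refine ⟨fun _ => ?_, fun i j hij => absurd (Subsingleton.elim i j) hij⟩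
    rw [Set.domRestrict_apply, EuclideanSpace.norm_eq, Real.sqrt_eq_one]
    simpa [dotProduct, sq] using hw
  obtain ⟨b, hb⟩ := orthonormal.exists_orthonormalBasis_extension_of_card_eq (by simp)
  refine ⟨_, (EuclideanSpace.basisFun ι ℝ).toMatrix_orthonormalBasis_mem_orthogonal b, ?_⟩
  ext i
  simp [Module.Basis.toMatrix_apply, hb i₀ rfl]

open scoped MatrixOrder Matrix.Norms.L2Operator in
theorem exists_eq_transpose_mul_self {A : Matrix ι ι ℝ} (hA : A.PosDef) :
    ∃ Y : Matrix ι ι ℝ, IsUnit Y.det ∧ A = Yᵀ * Y := by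
  obtain ⟨Y, hY, hYA⟩ := CStarAlgebra.isStrictlyPositive_iff_eq_star_mul_self.mp
    hA.isStrictlyPositive
  exact ⟨Y, (isUnit_iff_isUnit_det Y).1 hY, hYA⟩

theorem exists_congruence_one_col_eq {A : Matrix ι ι ℝ} (hA : A.PosDef) (i₀ : ι) :
    ∃ B : Matrix ι ι ℝ, Bᵀ * A * B = 1 ∧ B.col i₀ = Pi.single i₀ (√(A i₀ i₀))⁻¹ := by
  obtain ⟨Y, hY, rfl⟩ := exists_eq_transpose_mul_self hA
  set r := √((Yᵀ * Y) i₀ i₀)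
  have hr : r ≠ 0 := (Real.sqrt_pos.2 hA.diag_pos).ne'
  have col_dot_col : Y.col i₀ ⬝ᵥ Y.col i₀ = r * r := (Real.mul_self_sqrt hA.diag_pos.le).symm
  obtain ⟨O, hO, hcol⟩ := exists_mem_orthogonalGroup_col_eq (w := r⁻¹ • Y.col i₀)
    (by simp only [smul_dotProduct, dotProduct_smul, col_dot_col, smul_eq_mul]; field_simp) i₀
  refine ⟨Y⁻¹ * O, ?_, ?_⟩
  · calc (Y⁻¹ * O)ᵀ * (Yᵀ * Y) * (Y⁻¹ * O) = Oᵀ * (Y * Y⁻¹)ᵀ * (Y * Y⁻¹) * O := by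
          simp only [transpose_mul, Matrix.mul_assoc]
      _ = 1 := by simpa [mul_nonsing_inv _ hY, star_eq_conjTranspose] using
          (mem_orthogonalGroup_iff' ι ℝ).1 hO
  · calc (Y⁻¹ * O).col i₀ = Y⁻¹ *ᵥ O.col i₀ := rfl
      _ = r⁻¹ • (Y⁻¹ * Y).col i₀ := by rw [hcol, mulVec_smul]; rfl
      _ = Pi.single i₀ r⁻¹ := by
        rw [nonsing_inv_mul _ hY]
        ext i
        simp [one_apply, Pi.single_apply]

end Congruence

section DirectionalDerivatives

variable {E : Type*} [NormedAddCommGroup E] [NormedSpace ℝ E]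

/-- The directional derivative `∂ₐg`, as a function of the point so that it can be iterated. -/
noncomputable def dirDeriv (a : E) (g : E → ℝ) (x : E) : ℝ := lineDeriv ℝ g x a

variable {g h : E → ℝ} {x : E}

theorem dirDeriv_eq_fderiv (hg : DifferentiableAt ℝ g x) (a : E) :
    dirDeriv a g x = fderiv ℝ g x a :=
  hg.lineDeriv_eq_fderiv

theorem eventually_differentiableAt {k : WithTop ℕ∞} (hg : ContDiffAt ℝ k g x) (hk : 1 ≤ k) :
    ∀ᶠ y in 𝓝 x, DifferentiableAt ℝ g y :=
  ((hg.of_le hk).eventually (by simp)).mono fun _ hy => hy.differentiableAt one_ne_zero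

theorem contDiffAt_dirDeriv {k l : WithTop ℕ∞} (hg : ContDiffAt ℝ k g x) (hkl : l + 1 ≤ k)
    (a : E) : ContDiffAt ℝ l (dirDeriv a g) x := by
  have apply_a : ContDiffAt ℝ l (fun y => fderiv ℝ g y a) x :=
    (hg.fderiv_right hkl).clm_apply contDiffAt_const
  refine apply_a.congr_of_eventuallyEq ?_
  filter_upwards [eventually_differentiableAt hg (le_add_self.trans hkl)] with y hy
    using dirDeriv_eq_fderiv hy a

theorem dirDeriv_congr (hgh : g =ᶠ[𝓝 x] h) (a : E) : dirDeriv a g x = dirDeriv a h x :=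
  hgh.lineDeriv_eq

theorem dirDeriv_dirDeriv_eq_fderiv_fderiv (hg : ContDiffAt ℝ 2 g x) (a b : E) :
    dirDeriv a (dirDeriv b g) x = fderiv ℝ (fderiv ℝ g) x a b := by
  have hd : DifferentiableAt ℝ (fderiv ℝ g) x :=
    (hg.fderiv_right (m := 1) (by norm_num)).differentiableAt one_ne_zero
  have eq_fderiv : dirDeriv b g =ᶠ[𝓝 x] fun y => fderiv ℝ g y b :=
    (eventually_differentiableAt hg one_le_two).mono fun y hy => dirDeriv_eq_fderiv hy b
  rw [dirDeriv_congr eq_fderiv, dirDeriv_eq_fderiv (hd.clm_apply (differentiableAt_const b)),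
    fderiv_clm_apply hd (differentiableAt_const b)]
  simp

theorem dirDeriv_comm (hg : ContDiffAt ℝ 2 g x) (a b : E) :
    dirDeriv a (dirDeriv b g) x = dirDeriv b (dirDeriv a g) x := by
  rw [dirDeriv_dirDeriv_eq_fderiv_fderiv hg, dirDeriv_dirDeriv_eq_fderiv_fderiv hg]
  exact hg.isSymmSndFDerivAt (by simp) a b

theorem dirDeriv_comm₃ (hg : ContDiffAt ℝ 3 g x) (a b c : E) :
    dirDeriv a (dirDeriv b (dirDeriv c g)) x = dirDeriv b (dirDeriv c (dirDeriv a g)) x := by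
  rw [dirDeriv_comm (contDiffAt_dirDeriv hg (by norm_num) c)]
  exact dirDeriv_congr (((hg.of_le (m := 2) (by norm_num)).eventually (by simp)).mono
    fun y hy => dirDeriv_comm hy a c) b

theorem dirDeriv_smul (c : ℝ) (a : E) (g : E → ℝ) : dirDeriv (c • a) g = c • dirDeriv a g :=
  funext fun x => by simp [dirDeriv, lineDeriv_smul]

theorem dirDeriv_const_smul (c : ℝ) (a : E) (g : E → ℝ) :
    dirDeriv a (c • g) = c • dirDeriv a g :=
  funext fun _ => deriv_const_mul_field c

theorem tendsto_line (x a : E) : Tendsto (fun t : ℝ => x + t • a) (𝓝 0) (𝓝 x) := by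
  have : ContinuousAt (fun t : ℝ => x + t • a) 0 := by fun_prop
  simpa [ContinuousAt] using this

theorem hasDerivAt_line {a : E} {t : ℝ} (hg : DifferentiableAt ℝ g (x + t • a)) :
    HasDerivAt (fun s => g (x + s • a)) (dirDeriv a g (x + t • a)) t := by
  rw [dirDeriv_eq_fderiv hg]
  exact hg.hasFDerivAt.comp_hasDerivAt t
    (by simpa using ((hasDerivAt_id t).smul_const a).const_add x)

theorem hasDerivAt_line_zero (hg : DifferentiableAt ℝ g x) (a : E) :
    HasDerivAt (fun s : ℝ => g (x + s • a)) (dirDeriv a g x) 0 := by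
  simpa using hasDerivAt_line (t := 0) (a := a) (by simpa using hg)

theorem eventually_hasDerivAt_line {k : WithTop ℕ∞} (hg : ContDiffAt ℝ k g x) (hk : 1 ≤ k) (a : E) :
    ∀ᶠ t in 𝓝 (0 : ℝ), HasDerivAt (fun s => g (x + s • a)) (dirDeriv a g (x + t • a)) t :=
  ((tendsto_line x a).eventually (eventually_differentiableAt hg hk)).mono fun _ => hasDerivAt_line

theorem hasDerivAt_dirDeriv_line_zero (hg : ContDiffAt ℝ 2 g x) (a : E) :
    HasDerivAt (fun s : ℝ => dirDeriv a g (x + s • a)) (dirDeriv a (dirDeriv a g) x) 0 :=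
  hasDerivAt_line_zero
    ((contDiffAt_dirDeriv hg (by norm_num) a).differentiableAt one_ne_zero) a

theorem isLocalMax_line (hmax : IsLocalMax g x) (a : E) :
    IsLocalMax (fun t : ℝ => g (x + t • a)) 0 := by
  simpa [IsLocalMax, IsMaxFilter] using (tendsto_line x a).eventually hmax

theorem dirDeriv_dirDeriv_nonpos_of_isLocalMax (hg : ContDiffAt ℝ 2 g x) (hmax : IsLocalMax g x)
    (a : E) : dirDeriv a (dirDeriv a g) x ≤ 0 :=
  second_deriv_nonpos_of_isLocalMax (isLocalMax_line hmax a)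
    (eventually_hasDerivAt_line hg one_le_two a) (hasDerivAt_dirDeriv_line_zero hg a)

theorem dirDeriv_dirDeriv_nonneg_of_convexOn {V : Set E} (hV : IsOpen V) (hg : ContDiffOn ℝ 2 g V)
    (hc : ConvexOn ℝ V g) (hx : x ∈ V) (a : E) : 0 ≤ dirDeriv a (dirDeriv a g) x := by
  let L : ℝ →ᵃ[ℝ] E := AffineMap.lineMap x (x + a)
  have hL : ⇑L = fun t => x + t • a :=
    funext fun t => by simp [L, AffineMap.lineMap_apply, add_comm]
  have hS : IsOpen (L ⁻¹' V) := hV.preimage (by rw [hL]; fun_prop)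
  have h0 : (0 : ℝ) ∈ L ⁻¹' V := by simpa [hL] using hx
  have hderiv : ∀ t ∈ L ⁻¹' V, HasDerivAt (g ∘ L) (dirDeriv a g (x + t • a)) t := by
    intro t ht
    rw [hL] at ht ⊢
    exact hasDerivAt_line ((hg.contDiffAt (hV.mem_nhds ht)).differentiableAt two_ne_zero)
  have monotone : MonotoneOn (deriv (g ∘ L)) (L ⁻¹' V) :=
    (hc.comp_affineMap L).monotoneOn_deriv fun t ht => (hderiv t ht).differentiableAt
  have hderiv₂ : HasDerivAt (deriv (g ∘ L)) (dirDeriv a (dirDeriv a g) x) 0 :=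
    (hasDerivAt_dirDeriv_line_zero (hg.contDiffAt (hV.mem_nhds hx)) a).congr_of_eventuallyEq <| by
      filter_upwards [hS.mem_nhds h0] with t ht using (hderiv t ht).deriv
  rw [← hderiv₂.deriv, ← derivWithin_of_isOpen hS h0]
  exact monotone.derivWithin_nonneg

theorem hasDerivAt_dirDeriv_div_line_zero (hg : ContDiffAt ℝ 2 g x) (h0 : g x ≠ 0) (a : E) :
    HasDerivAt (fun s : ℝ => dirDeriv a g (x + s • a) / g (x + s • a))
      (dirDeriv a (dirDeriv a g) x / g x - (dirDeriv a g x / g x) ^ 2) 0 := by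
  have hg' : HasDerivAt (fun s : ℝ => g (x + s • a)) (dirDeriv a g (x + (0 : ℝ) • a)) 0 := by
    simpa using hasDerivAt_line_zero (hg.differentiableAt two_ne_zero) a
  simpa using hasDerivAt_div_self (p' := fun s : ℝ => dirDeriv a g (x + s • a)) hg'
    (hasDerivAt_dirDeriv_line_zero hg a) (by simpa using h0)

theorem conditions_of_isLocalMax_mul_mul_exp {w g p : E → ℝ} {γ : ℝ} (hw : ContDiffAt ℝ 2 w x)
    (hg : ContDiffAt ℝ 2 g x) (hp : ContDiffAt ℝ 2 p x) (hw0 : 0 < w x) (hg0 : 0 < g x)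
    (hmax : IsLocalMax (fun y => w y * (g y * Real.exp (γ / 2 * p y ^ 2))) x) (a : E) :
    dirDeriv a w x / w x + dirDeriv a g x / g x + γ * (p x * dirDeriv a p x) = 0 ∧
      (dirDeriv a (dirDeriv a w) x / w x - (dirDeriv a w x / w x) ^ 2)
        + (dirDeriv a (dirDeriv a g) x / g x - (dirDeriv a g x / g x) ^ 2)
        + γ * (dirDeriv a p x ^ 2 + p x * dirDeriv a (dirDeriv a p) x) ≤ 0 := by
  let φ' : E → ℝ := fun y =>
    dirDeriv a w y / w y + dirDeriv a g y / g y + γ * (p y * dirDeriv a p y)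
  have first : ∀ᶠ t in 𝓝 (0 : ℝ), HasDerivAt (fun s => Real.log (w (x + s • a))
      + Real.log (g (x + s • a)) + γ / 2 * p (x + s • a) ^ 2) (φ' (x + t • a)) t := by
    filter_upwards [(tendsto_line x a).eventually (hw.continuousAt.eventually (lt_mem_nhds hw0)),
      (tendsto_line x a).eventually (hg.continuousAt.eventually (lt_mem_nhds hg0)),
      eventually_hasDerivAt_line hw one_le_two a, eventually_hasDerivAt_line hg one_le_two a,
      eventually_hasDerivAt_line hp one_le_two a] with t hw0 hg0 hw hg hp
    refine (((hw.log hw0.ne').add (hg.log hg0.ne')).add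
      ((hp.pow 2).const_mul (γ / 2))).congr_deriv ?_
    simp only [φ']
    ring
  have second := ((hasDerivAt_dirDeriv_div_line_zero hw hw0.ne' a).add
    (hasDerivAt_dirDeriv_div_line_zero hg hg0.ne' a)).add
    (((hasDerivAt_line_zero (hp.differentiableAt two_ne_zero) a).mul
      (hasDerivAt_dirDeriv_line_zero hp a)).const_mul γ)
  have hmax_line := isLocalMax_line
    (isLocalMax_log_add_log_add hw.continuousAt hg.continuousAt hw0 hg0 hmax) a
  refine ⟨by simpa [φ'] using hmax_line.hasDerivAt_eq_zero first.self_of_nhds, ?_⟩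
  have := second_deriv_nonpos_of_isLocalMax hmax_line first second
  simpa [sq] using this

end DirectionalDerivatives

section TraceInequality

variable {n : ℕ}

theorem sum_sq_add_sum_sq_le_trace_mul_self {T : Matrix (Fin (n + 1)) (Fin (n + 1)) ℝ}
    (hT : T.IsSymm) : ∑ k, T k 0 ^ 2 + ∑ i : Fin n, T i.succ 0 ^ 2
      + ∑ i : Fin n, T i.succ i.succ ^ 2 ≤ (T * T).trace := by
  have trace_eq : (T * T).trace = ∑ i, ∑ k, T k i ^ 2 :=
    Finset.sum_congr rfl fun i _ => (mul_apply ..).trans <|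
      Finset.sum_congr rfl fun k _ => by rw [hT.apply k i, sq]
  have column_ge (i : Fin n) : T i.succ 0 ^ 2 + T i.succ i.succ ^ 2 ≤ ∑ k, T k i.succ ^ 2 := by
    rw [Fin.sum_univ_succ, hT.apply i.succ 0]
    gcongr
    exact Finset.single_le_sum (f := fun k : Fin n => T k.succ i.succ ^ 2)
      (fun _ _ => sq_nonneg _) (Finset.mem_univ i)
  rw [trace_eq, Fin.sum_univ_succ (f := fun i => ∑ k, T k i ^ 2), add_assoc,
    ← Finset.sum_add_distrib]
  gcongr with i
  exact column_ge i

/-- Cauchy-Schwarz with weights `β - n, 1, …, 1` adding up to `β`: at the maximum the first entry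
is determined by the first order condition, so it may be given any positive weight. -/
theorem sq_trace_div_le (T : Matrix (Fin (n + 1)) (Fin (n + 1)) ℝ) {β : ℝ} (hβ : n < β) :
    T.trace ^ 2 / β ≤ T 0 0 ^ 2 / (β - n) + ∑ i : Fin n, T i.succ i.succ ^ 2 := by
  have weights_pos : ∀ i ∈ Finset.univ, 0 < (Fin.cons (β - n) 1 : Fin (n + 1) → ℝ) i :=
    fun i _ => by cases i using Fin.cases <;> simp [hβ]
  simpa [trace, Fin.sum_univ_succ] using
    Finset.sq_sum_div_le_sum_sq_div Finset.univ (fun i => T i i) weights_pos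

end TraceInequality

section Frames

variable {E ι : Type*} [NormedAddCommGroup E] [NormedSpace ℝ E] {g : E → ℝ} {x : E}

/-- The matrix of the Hessian of `g` at `x`, as a bilinear form, on the vectors `b i`. -/
noncomputable def frameHessian (b : ι → E) (g : E → ℝ) (x : E) : Matrix ι ι ℝ :=
  of fun i j => dirDeriv (b i) (dirDeriv (b j) g) x

theorem isSymm_frameHessian (hg : ContDiffAt ℝ 2 g x) (b : ι → E) :
    (frameHessian b g x).IsSymm :=
  IsSymm.ext fun i j => dirDeriv_comm hg (b j) (b i)

theorem frameHessian_sum [Fintype ι] {κ : Type*} (hg : ContDiffAt ℝ 2 g x) (b : ι → E)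
    (B : Matrix ι κ ℝ) :
    frameHessian (fun k => ∑ i, B i k • b i) g x = Bᵀ * frameHessian b g x * B := by
  ext k l
  simp only [frameHessian, mul_apply, dirDeriv_dirDeriv_eq_fderiv_fderiv hg, Finset.sum_mul,
    Finset.mul_sum, of_apply, map_sum, map_smul, _root_.sum_apply, _root_.smul_apply, smul_eq_mul,
    transpose_apply]
  exact Finset.sum_congr rfl fun i _ => Finset.sum_congr rfl fun j _ => by ring

theorem hasDerivAt_frameHessian_line [Finite ι] {a : E} {t : ℝ}
    (hg : ContDiffAt ℝ 3 g (x + t • a)) (b : ι → E) :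
    HasDerivAt (fun s : ℝ => frameHessian b g (x + s • a))
      (frameHessian b (dirDeriv a g) (x + t • a)) t := by
  refine hasDerivAt_matrix_iff.2 fun i j => ?_
  have hg_ij : ContDiffAt ℝ 1 (dirDeriv (b i) (dirDeriv (b j) g)) (x + t • a) :=
    contDiffAt_dirDeriv (contDiffAt_dirDeriv hg (l := 2) (by norm_num) _) (by norm_num) _
  exact (hasDerivAt_line (hg_ij.differentiableAt one_ne_zero)).congr_deriv
    (dirDeriv_comm₃ hg a (b i) (b j))

/-- `Real.log` is `log |·|`, so `dirDeriv d g` may be negative. -/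
theorem trace_of_log_det_frameHessian_eq [Fintype ι] [DecidableEq ι] {b : ι → E} {d e : E}
    {β c : ℝ} (hg : ContDiffAt ℝ 4 g x) (h1 : frameHessian b g x = 1) (hd : dirDeriv d g x ≠ 0)
    (hdet : ∀ᶠ t in 𝓝 (0 : ℝ), Real.log (frameHessian b g (x + t • e)).det =
      c + β * Real.log (dirDeriv d g (x + t • e))) :
    (frameHessian b (dirDeriv e g) x).trace = β * (dirDeriv e (dirDeriv d g) x / dirDeriv d g x) ∧
      (frameHessian b (dirDeriv e (dirDeriv e g)) x).trace =
        (frameHessian b (dirDeriv e g) x * frameHessian b (dirDeriv e g) x).trace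
          + β * (dirDeriv e (dirDeriv e (dirDeriv d g)) x / dirDeriv d g x
            - (dirDeriv e (dirDeriv d g) x / dirDeriv d g x) ^ 2) := by
  have hg3 : ∀ᶠ t in 𝓝 (0 : ℝ), ContDiffAt ℝ 3 g (x + t • e) :=
    (tendsto_line x e).eventually ((hg.of_le (by norm_num)).eventually (by simp))
  have hdg : ContDiffAt ℝ 3 (dirDeriv d g) x := contDiffAt_dirDeriv hg (by norm_num) d
  have heg : ContDiffAt ℝ 3 (dirDeriv e g) x := contDiffAt_dirDeriv hg (by norm_num) e
  have heg0 : ContDiffAt ℝ 3 (dirDeriv e g) (x + (0 : ℝ) • e) := by simpa using heg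
  have key := trace_of_log_det_eq (t := 0) (by simpa using h1)
    (hg3.mono fun t ht => hasDerivAt_frameHessian_line ht b)
    (hasDerivAt_frameHessian_line heg0 b) (eventually_hasDerivAt_line hdg (by norm_num) e)
    (hasDerivAt_dirDeriv_line_zero (hdg.of_le (by norm_num)) e) (by simpa using hd) hdet
  simpa using key

end Frames

section AuxiliaryFunction

variable {E : Type*} [NormedAddCommGroup E] [NormedSpace ℝ E] {v : E → ℝ} {x : E}

/-- The affine combination `ℓ + c v + r` of a linear form, a function and a constant. For suitable
parameters it is the boundary cut-off of the Pogorelov argument. -/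
def cutoff (ℓ : E →L[ℝ] ℝ) (c r : ℝ) (v : E → ℝ) (y : E) : ℝ := ℓ y + c * v y + r

theorem contDiffAt_cutoff {k : WithTop ℕ∞} (hv : ContDiffAt ℝ k v x) (ℓ : E →L[ℝ] ℝ) (c r : ℝ) :
    ContDiffAt ℝ k (cutoff ℓ c r v) x :=
  (ℓ.contDiff.contDiffAt.add (contDiffAt_const.mul hv)).add contDiffAt_const

theorem dirDeriv_cutoff (hv : DifferentiableAt ℝ v x) (ℓ : E →L[ℝ] ℝ) (c r : ℝ) (a : E) :
    dirDeriv a (cutoff ℓ c r v) x = ℓ a + c * dirDeriv a v x := by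
  have hcutoff : HasFDerivAt (cutoff ℓ c r v) (ℓ + c • fderiv ℝ v x) x :=
    (ℓ.hasFDerivAt.add (hv.hasFDerivAt.const_mul c)).add_const r
  rw [dirDeriv_eq_fderiv hcutoff.differentiableAt, hcutoff.fderiv, dirDeriv_eq_fderiv hv]
  simp

theorem dirDeriv_dirDeriv_cutoff (hv : ContDiffAt ℝ 2 v x) (ℓ : E →L[ℝ] ℝ) (c r : ℝ) (a b : E) :
    dirDeriv a (dirDeriv b (cutoff ℓ c r v)) x = c * dirDeriv a (dirDeriv b v) x := by
  have first : dirDeriv b (cutoff ℓ c r v) =ᶠ[𝓝 x] cutoff 0 c (ℓ b) (dirDeriv b v) := by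
    filter_upwards [eventually_differentiableAt hv one_le_two] with y hy
    simp [dirDeriv_cutoff hy, cutoff, add_comm]
  have hbv := (contDiffAt_dirDeriv hv (l := 1) (by norm_num) b).differentiableAt one_ne_zero
  simp [dirDeriv_congr first, dirDeriv_cutoff hbv]

/-- Pogorelov's auxiliary function `w ∂ₑ∂ₑv exp (γ (∂ₑv)² / 2)`. -/
noncomputable def pogorelov (w v : E → ℝ) (e : E) (γ : ℝ) (y : E) : ℝ :=
  w y * (dirDeriv e (dirDeriv e v) y * Real.exp (γ / 2 * dirDeriv e v y ^ 2))

theorem pogorelov_smul (w v : E → ℝ) (e : E) (γ r : ℝ) :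
    pogorelov w v (r • e) γ = r ^ 2 • pogorelov w v e (γ * r ^ 2) := by
  ext y
  simp only [pogorelov, dirDeriv_smul, dirDeriv_const_smul, Pi.smul_apply, smul_eq_mul, mul_pow]
  ring_nf

/-- The elimination of the third and fourth derivatives of `v` at a maximum of `pogorelov w v e γ`,
for a frame `b` with `b 0 = e` on which the Hessian of `v` is the identity: `T` and `S` are the
Hessians of `∂ₑv` and `∂ₑ∂ₑv` on this frame, `ω k = ∂w/w` along `b k`, `p = ∂ₑv`, `q = ∂_d v`,
`Y = ∂ₑ∂_d v` and `X = ∂ₑ∂ₑ∂_d v`. -/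
theorem inequality_of_conditions {n : ℕ} {T S : Matrix (Fin (n + 1)) (Fin (n + 1)) ℝ}
    {ω : Fin (n + 1) → ℝ} {β γ c w p q X Y : ℝ} (hT : T.IsSymm) (hβ : n < β) (hq : q ≠ 0)
    (trT : T.trace = β * (Y / q))
    (trS : S.trace = (T * T).trace + β * (X / q - (Y / q) ^ 2))
    (first_d : (-1 + c * q) / w + X + γ * (p * Y) = 0)
    (first : ∀ k, ω k + T k 0 + γ * (p * (1 : Matrix (Fin (n + 1)) (Fin (n + 1)) ℝ) k 0) = 0)
    (second : ∀ k, (c / w - ω k ^ 2) + (S k k - T k 0 ^ 2)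
      + γ * ((1 : Matrix (Fin (n + 1)) (Fin (n + 1)) ℝ) k 0 ^ 2 + p * T k k) ≤ 0) :
    (c * (n + 1 - β) + β / q) / w + γ - ω 0 ^ 2 - (ω 0 + γ * p) ^ 2 / (β - n) ≤ 0 := by
  have T_zero : T 0 0 = -(ω 0 + γ * p) := by
    linear_combination (by simpa using first 0 : ω 0 + T 0 0 + γ * p = 0)
  have ω_succ (i : Fin n) : ω i.succ ^ 2 = T i.succ 0 ^ 2 := by
    have : ω i.succ + T i.succ 0 = 0 := by simpa [one_apply] using first i.succ
    rw [eq_neg_of_add_eq_zero_left this, neg_sq]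
  have sum_second : (n + 1) * (c / w) - ∑ k, ω k ^ 2 + (S.trace - ∑ k, T k 0 ^ 2)
      + γ * (1 + p * T.trace) ≤ 0 := by
    have := Finset.sum_nonpos fun k (_ : k ∈ Finset.univ) => second k
    simpa [Finset.sum_add_distrib, ← Finset.mul_sum, one_apply, trace] using this
  have trace_eq : S.trace + γ * (p * T.trace) =
      (T * T).trace - T.trace ^ 2 / β + (β / q - β * c) / w := by
    have : β ≠ 0 := (n.cast_nonneg.trans_lt hβ).ne'
    rw [trS, trT]
    field_simp
    linear_combination q * β * first_d
  have trace_ge := sum_sq_add_sum_sq_le_trace_mul_self hT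
  have trace_sq_le := sq_trace_div_le T hβ
  rw [T_zero, neg_sq] at trace_sq_le
  rw [Fin.sum_univ_succ (f := fun k => ω k ^ 2)] at sum_second
  simp only [ω_succ] at sum_second
  have : (c * (n + 1 - β) + β / q) / w = (n + 1) * (c / w) + (β / q - β * c) / w := by ring
  linarith

theorem inequality_of_isLocalMax_pogorelov {n : ℕ} {b : Fin (n + 1) → E} {d : E}
    {ℓ : E →L[ℝ] ℝ} {β γ c r κ : ℝ} (hv : ContDiffAt ℝ 4 v x) (hb : frameHessian b v x = 1)
    (hd : dirDeriv d v x ≠ 0) (hℓb : ℓ (b 0) = 0) (hℓd : ℓ d = -1) (hβ : n < β)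
    (hdet : ∀ᶠ t in 𝓝 (0 : ℝ), Real.log (frameHessian b v (x + t • b 0)).det =
      κ + β * Real.log (dirDeriv d v (x + t • b 0)))
    (hw : 0 < cutoff ℓ c r v x)
    (hmax : IsLocalMax (pogorelov (cutoff ℓ c r v) v (b 0) γ) x) :
    (c * (n + 1 - β) + β / dirDeriv d v x) / cutoff ℓ c r v x + γ
        - (c * dirDeriv (b 0) v x / cutoff ℓ c r v x) ^ 2
        - (c * dirDeriv (b 0) v x / cutoff ℓ c r v x + γ * dirDeriv (b 0) v x) ^ 2 / (β - n)
      ≤ 0 := by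
  have hev : ContDiffAt ℝ 3 (dirDeriv (b 0) v) x := contDiffAt_dirDeriv hv (by norm_num) (b 0)
  have heev : ContDiffAt ℝ 2 (dirDeriv (b 0) (dirDeriv (b 0) v)) x :=
    contDiffAt_dirDeriv hev (by norm_num) (b 0)
  have hv₂ : ContDiffAt ℝ 2 v x := hv.of_le (by norm_num)
  have orthonormal (j k : Fin (n + 1)) :
      dirDeriv (b j) (dirDeriv (b k) v) x = (1 : Matrix _ _ ℝ) j k := congrFun₂ hb j k
  have ev_one : dirDeriv (b 0) (dirDeriv (b 0) v) x = 1 := by simp [orthonormal]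
  obtain ⟨trT, trS⟩ := trace_of_log_det_frameHessian_eq hv hb hd hdet
  have conditions := conditions_of_isLocalMax_mul_mul_exp
    (contDiffAt_cutoff hv₂ ℓ c r) heev (hev.of_le (by norm_num)) hw (by simp [ev_one]) hmax
  simp only [dirDeriv_cutoff (hv₂.differentiableAt two_ne_zero), dirDeriv_dirDeriv_cutoff hv₂,
    ev_one, div_one] at conditions
  have key := inequality_of_conditions (p := dirDeriv (b 0) v x) (γ := γ) (c := c)
    (w := cutoff ℓ c r v x) (ω := fun k => (ℓ (b k) + c * dirDeriv (b k) v x) / cutoff ℓ c r v x)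
    (isSymm_frameHessian (hev.of_le (by norm_num)) b) hβ hd trT trS ?_ ?_ ?_
  · simpa [hℓb] using key
  · rw [← hℓd, ← dirDeriv_comm hv₂, ← dirDeriv_comm₃ (hv.of_le (by norm_num))]
    exact (conditions d).1
  · intro k
    simpa only [frameHessian, of_apply, orthonormal] using (conditions (b k)).1
  · intro k
    simpa only [frameHessian, of_apply, orthonormal, one_apply_eq, mul_one] using
      (conditions (b k)).2

end AuxiliaryFunction

section Scaling

variable {E : Type*} [NormedAddCommGroup E] [NormedSpace ℝ E] {v : E → ℝ} {x : E}

theorem exists_log_det_frameHessian_sum_eq {ι : Type*} [Fintype ι] [DecidableEq ι] {b : ι → E}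
    {a d : E} {β f : ℝ} {B : Matrix ι ι ℝ} (hv : ContDiffAt ℝ 2 v x) (hB : B.det ≠ 0) (hf : 0 < f)
    (hd : dirDeriv d v x < 0) (hdet : ∀ᶠ t in 𝓝 (0 : ℝ),
      (frameHessian b v (x + t • a)).det = f * (-dirDeriv d v (x + t • a)) ^ β) :
    ∃ κ, ∀ᶠ t in 𝓝 (0 : ℝ),
      Real.log (frameHessian (fun k => ∑ i, B i k • b i) v (x + t • a)).det =
        κ + β * Real.log (dirDeriv d v (x + t • a)) := by
  have hv_near := (tendsto_line x a).eventually (hv.eventually (by simp))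
  have hd_near := (tendsto_line x a).eventually
    ((contDiffAt_dirDeriv hv (l := 1) (by norm_num) d).continuousAt.eventually (gt_mem_nhds hd))
  refine ⟨Real.log (B.det ^ 2 * f), ?_⟩
  filter_upwards [hv_near, hd_near, hdet] with t hvt hdt hdet
  have hq : 0 < -dirDeriv d v (x + t • a) := neg_pos.2 hdt
  have det_eq : (frameHessian (fun k => ∑ i, B i k • b i) v (x + t • a)).det =
      B.det ^ 2 * f * (-dirDeriv d v (x + t • a)) ^ β := by
    rw [frameHessian_sum hvt, det_mul, det_mul, det_transpose, hdet]
    ring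
  rw [det_eq, Real.log_mul (by positivity) (by positivity), Real.log_rpow hq, Real.log_neg_eq_log]

theorem inequality_of_isLocalMax_pogorelov_of_posDef {n : ℕ} {b : Fin (n + 1) → E} {d : E}
    {ℓ : E →L[ℝ] ℝ} {β γ c r f : ℝ} (hv : ContDiffAt ℝ 4 v x) (hb : (frameHessian b v x).PosDef)
    (hd : dirDeriv d v x < 0) (hℓb : ℓ (b 0) = 0) (hℓd : ℓ d = -1) (hβ : n < β) (hf : 0 < f)
    (hdet : ∀ᶠ t in 𝓝 (0 : ℝ),
      (frameHessian b v (x + t • b 0)).det = f * (-dirDeriv d v (x + t • b 0)) ^ β)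
    (hw : 0 < cutoff ℓ c r v x)
    (hmax : IsLocalMax (pogorelov (cutoff ℓ c r v) v (b 0) γ) x) :
    (c * (n + 1 - β) + β / dirDeriv d v x) / cutoff ℓ c r v x
        + γ * dirDeriv (b 0) (dirDeriv (b 0) v) x
        - (c * dirDeriv (b 0) v x / cutoff ℓ c r v x) ^ 2 / dirDeriv (b 0) (dirDeriv (b 0) v) x
        - (c * dirDeriv (b 0) v x / cutoff ℓ c r v x
            + γ * dirDeriv (b 0) (dirDeriv (b 0) v) x * dirDeriv (b 0) v x) ^ 2
          / (dirDeriv (b 0) (dirDeriv (b 0) v) x * (β - n)) ≤ 0 := by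
  have hv₂ : ContDiffAt ℝ 2 v x := hv.of_le (by norm_num)
  set l := dirDeriv (b 0) (dirDeriv (b 0) v) x
  obtain ⟨B, hB, hcol : B.col 0 = Pi.single 0 (√l)⁻¹⟩ := exists_congruence_one_col_eq hb 0
  have hl : 0 < l := hb.diag_pos
  have sqrt_sq : (√l)⁻¹ ^ 2 = l⁻¹ := by rw [inv_pow, Real.sq_sqrt hl.le]
  have det_ne : B.det ≠ 0 := fun h => by simpa [h] using congrArg det hB
  set b' : Fin (n + 1) → E := fun k => ∑ i, B i k • b i 
  have b'_zero : b' 0 = (√l)⁻¹ • b 0 := by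
    have (i : Fin (n + 1)) : B i 0 = (Pi.single 0 (√l)⁻¹ : Fin (n + 1) → ℝ) i := congrFun hcol i
    simp [b', this, Pi.single_apply, ite_smul]
  have hdet' : ∀ᶠ t in 𝓝 (0 : ℝ),
      (frameHessian b v (x + t • b' 0)).det = f * (-dirDeriv d v (x + t • b' 0)) ^ β := by
    have rescale : Tendsto (fun t : ℝ => t * (√l)⁻¹) (𝓝 0) (𝓝 0) := by
      simpa using (continuous_mul_const (√l)⁻¹).tendsto 0
    simpa [b'_zero, smul_smul] using rescale.eventually hdet
  obtain ⟨κ, hκ⟩ := exists_log_det_frameHessian_sum_eq hv₂ det_ne hf hd hdet'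
  have hmax' : IsLocalMax (pogorelov (cutoff ℓ c r v) v (b' 0) (γ * l)) x := by
    rw [b'_zero, pogorelov_smul, sqrt_sq, mul_assoc, mul_inv_cancel₀ hl.ne', mul_one]
    filter_upwards [hmax] with y hy
    simpa using mul_le_mul_of_nonneg_left hy (inv_nonneg.2 hl.le)
  have key := inequality_of_isLocalMax_pogorelov (b := b') hv
    ((frameHessian_sum hv₂ b B).trans hB) hd.ne (by rw [b'_zero, map_smul, hℓb, smul_zero]) hℓd hβ
    hκ hw hmax'
  rw [b'_zero, dirDeriv_smul, Pi.smul_apply, smul_eq_mul] at key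
  refine le_of_eq_of_le ?_ key
  have first_square : (c * dirDeriv (b 0) v x / cutoff ℓ c r v x) ^ 2 / l =
      (c * ((√l)⁻¹ * dirDeriv (b 0) v x) / cutoff ℓ c r v x) ^ 2 := by
    rw [mul_left_comm, mul_div_assoc (√l)⁻¹, mul_pow (√l)⁻¹, sqrt_sq, inv_mul_eq_div]
  have second_square : (c * dirDeriv (b 0) v x / cutoff ℓ c r v x
        + γ * l * dirDeriv (b 0) v x) ^ 2 / (l * (β - n)) =
      (c * ((√l)⁻¹ * dirDeriv (b 0) v x) / cutoff ℓ c r v x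
        + γ * l * ((√l)⁻¹ * dirDeriv (b 0) v x)) ^ 2 / (β - n) := by
    rw [mul_left_comm c, mul_left_comm (γ * l), mul_div_assoc (√l)⁻¹, ← mul_add, mul_pow (√l)⁻¹,
      sqrt_sq, inv_mul_eq_div, div_div]
  rw [first_square, second_square]

end Scaling

section Bound

theorem le_of_mul_sq_le {a b₁ b₀ t : ℝ} (ha : 0 < a) (hb₁ : 0 ≤ b₁) (hb₀ : 0 ≤ b₀)
    (h : a * t ^ 2 ≤ b₁ * t + b₀) : t ≤ 1 + (b₁ + b₀) / a := by
  by_contra! ht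
  have hab : 0 ≤ (b₁ + b₀) / a := by positivity
  have : b₁ + b₀ < a * t := by rw [← div_lt_iff₀' ha]; linarith
  nlinarith

theorem exists_bound_of_inequality (a M₁ M₂ c : ℝ) {β δ : ℝ} (hβ : 0 < β) (hδ : 0 < δ) :
    ∃ γ K : ℝ, 0 < γ ∧ 0 ≤ K ∧ ∀ w l p q : ℝ, 0 < w → 0 < l → |p| ≤ M₂ → -M₁ ≤ 1 / q →
      (a + β / q) / w + γ * l - (c * p / w) ^ 2 / l - (c * p / w + γ * l * p) ^ 2 / (l * δ) ≤ 0 →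
      w * l ≤ K := by
  set γ := δ / (4 * (M₂ ^ 2 + 1))
  have hγ : 0 < γ := by positivity
  refine ⟨γ, 1 + (|a| + β * |M₁| + (1 + 2 / δ) * (c * M₂) ^ 2) / (γ / 2), hγ, by positivity,
    fun w l p q hw hl hp hq h => le_of_mul_sq_le (by positivity) (by positivity)
      (by positivity) ?_⟩
  have hp_sq : p ^ 2 ≤ M₂ ^ 2 := sq_le_sq.2 (hp.trans (le_abs_self M₂))
  have multiplied : (a + β / q) * (w * l) + γ * (w * l) ^ 2 - (c * p) ^ 2
      - (c * p + γ * (w * l) * p) ^ 2 / δ ≤ 0 := by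
    have := mul_nonpos_of_nonneg_of_nonpos (a := w ^ 2 * l) (by positivity) h
    refine le_of_eq_of_le ?_ this
    field_simp
  have coefficient : -(|a| + β * |M₁|) ≤ a + β / q := by
    have : β * -|M₁| ≤ β * (1 / q) := by gcongr; linarith [le_abs_self M₁]
    linarith [neg_abs_le a, mul_one_div β q]
  have square_le : (c * p + γ * (w * l) * p) ^ 2 / δ ≤
      2 / δ * (c * p) ^ 2 + γ / 2 * (w * l) ^ 2 := by
    have γ_mul_le : γ * p ^ 2 ≤ δ / 4 := by
      have : γ * (M₂ ^ 2 + 1) = δ / 4 := by simp only [γ]; field_simp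
      nlinarith
    have := mul_le_mul_of_nonneg_left γ_mul_le (mul_nonneg hγ.le (sq_nonneg (w * l)))
    rw [div_le_iff₀ hδ, add_mul, mul_right_comm (2 / δ), div_mul_cancel₀ _ hδ.ne']
    nlinarith [sq_nonneg (c * p - γ * (w * l) * p)]
  have : (1 + 2 / δ) * (c * p) ^ 2 ≤ (1 + 2 / δ) * (c * M₂) ^ 2 := by
    rw [mul_pow, mul_pow]
    gcongr
  have := mul_le_mul_of_nonneg_right coefficient (mul_pos hw hl).le
  linarith

end Bound

section Estimate

theorem exists_isLocalMax_sub_mul {X : Type*} [TopologicalSpace X] {V : Set X} {w g : X → ℝ}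
    {ε : ℝ} {z : X} (hV : IsOpen V) (hw : ContinuousOn w V) (hg : ContinuousOn g V)
    (hg0 : ∀ y ∈ V, 0 < g y) (hK : IsCompact {y ∈ V | ε ≤ w y}) (hz : z ∈ V) (hεz : ε < w z) :
    ∃ y ∈ V, ε < w y ∧ IsLocalMax (fun x => (w x - ε) * g x) y ∧
      (w z - ε) * g z ≤ (w y - ε) * g y := by
  have hK_sub : {y ∈ V | ε ≤ w y} ⊆ V := Set.sep_subset V _
  obtain ⟨y, hy, hmax⟩ := hK.exists_isMaxOn ⟨z, hz, hεz.le⟩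
    (((hw.sub continuousOn_const).mul hg).mono hK_sub)
  have hzy : (w z - ε) * g z ≤ (w y - ε) * g y := hmax ⟨hz, hεz.le⟩
  have hεy : ε < w y := by
    have := (mul_pos (sub_pos.2 hεz) (hg0 z hz)).trans_le hzy
    exact sub_pos.1 (pos_of_mul_pos_left this (hg0 y hy.1).le)
  refine ⟨y, hy.1, hεy, ?_, hzy⟩
  filter_upwards [hV.mem_nhds hy.1, (hw.continuousAt (hV.mem_nhds hy.1)).eventually
    (lt_mem_nhds hεy)] with x hx hεx using hmax ⟨hx, hεx.le⟩

theorem le_of_dirDeriv_dirDeriv_pos {E : Type*} [NormedAddCommGroup E] [NormedSpace ℝ E]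
    [ProperSpace E] {Ω : Set E} {h : E → ℝ} {a x : E} {c : ℝ} (hΩ : IsOpen Ω)
    (hb : Bornology.IsBounded Ω) (hh : ContDiffOn ℝ 2 h Ω) (hcont : ContinuousOn h (closure Ω))
    (hpos : ∀ x ∈ Ω, 0 < dirDeriv a (dirDeriv a h) x) (hle : ∀ x ∈ frontier Ω, h x ≤ c)
    (hx : x ∈ Ω) : h x ≤ c := by
  obtain ⟨z, hz, hmax⟩ := hb.isCompact_closure.exists_isMaxOn ⟨x, subset_closure hx⟩ hcont
  have z_notMem : z ∉ Ω := fun hzΩ =>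
    (hpos z hzΩ).not_ge <| dirDeriv_dirDeriv_nonpos_of_isLocalMax
      (hh.contDiffAt (hΩ.mem_nhds hzΩ))
      (hmax.isLocalMax (mem_of_superset (hΩ.mem_nhds hzΩ) subset_closure)) a
  exact (hmax (subset_closure hx)).trans (hle z ⟨hz, by rwa [hΩ.interior_eq]⟩)

theorem le_of_le_on_frontier {E : Type*} [NormedAddCommGroup E] [NormedSpace ℝ E] [ProperSpace E]
    {Ω : Set E} {u : E → ℝ} {ℓ : E →L[ℝ] ℝ} {a x : E} (hΩ : IsOpen Ω)
    (hb : Bornology.IsBounded Ω) (hu : ContDiffOn ℝ 2 u Ω) (hcont : ContinuousOn u (closure Ω))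
    (hpos : ∀ x ∈ Ω, 0 < dirDeriv a (dirDeriv a u) x) (hle : ∀ x ∈ frontier Ω, u x ≤ ℓ x)
    (hx : x ∈ Ω) : u x ≤ ℓ x := by
  have cutoff_eq : cutoff (-ℓ) 1 0 u = fun x => -ℓ x + u x := funext fun x => by simp [cutoff]
  have huAt : ∀ x ∈ Ω, ContDiffAt ℝ 2 u x := fun x hx => hu.contDiffAt (hΩ.mem_nhds hx)
  have : cutoff (-ℓ) 1 0 u x ≤ 0 := le_of_dirDeriv_dirDeriv_pos (a := a) hΩ hb
    (fun x hx => (contDiffAt_cutoff (huAt x hx) (-ℓ) 1 0).contDiffWithinAt)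
    (by rw [cutoff_eq]; exact (-ℓ).continuous.continuousOn.add hcont)
    (fun x hx => by simpa [dirDeriv_dirDeriv_cutoff (huAt x hx)] using hpos x hx)
    (fun x hx => by simpa [cutoff_eq] using hle x hx) hx
  simpa [cutoff_eq] using this

theorem isCompact_sep_le {X : Type*} [PseudoMetricSpace X] [ProperSpace X] {Ω : Set X} {w : X → ℝ}
    {ε : ℝ} (hΩ : IsOpen Ω) (hb : Bornology.IsBounded Ω) (hw : ContinuousOn w (closure Ω))
    (hlt : ∀ x ∈ frontier Ω, w x < ε) : IsCompact {x ∈ Ω | ε ≤ w x} := by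
  have eq_closure : {x ∈ Ω | ε ≤ w x} = closure Ω ∩ w ⁻¹' Set.Ici ε := by
    refine Set.Subset.antisymm (fun x hx => ⟨subset_closure hx.1, hx.2⟩) fun x hx => ⟨?_, hx.2⟩
    by_contra hxΩ
    exact (hlt x ⟨hx.1, by rwa [hΩ.interior_eq]⟩).not_ge hx.2
  rw [eq_closure]
  exact hb.isCompact_closure.of_isClosed_subset
    (hw.preimage_isClosed_of_isClosed isClosed_closure isClosed_Ici) Set.inter_subset_left

variable {E : Type*} [NormedAddCommGroup E] [NormedSpace ℝ E]

theorem exists_isLocalMax_pogorelov {V : Set E} {v : E → ℝ} {e z : E} {ℓ : E →L[ℝ] ℝ} {c ε : ℝ}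
    (γ : ℝ) (hV : IsOpen V) (hv : ContDiffOn ℝ 2 v V)
    (hve : ∀ y ∈ V, 0 < dirDeriv e (dirDeriv e v) y)
    (hK : IsCompact {y ∈ V | ε ≤ cutoff ℓ c 0 v y}) (hz : z ∈ V) (hεz : ε < cutoff ℓ c 0 v z) :
    ∃ y ∈ V, 0 < cutoff ℓ c (-ε) v y ∧ IsLocalMax (pogorelov (cutoff ℓ c (-ε) v) v e γ) y ∧
      pogorelov (cutoff ℓ c (-ε) v) v e γ z ≤ pogorelov (cutoff ℓ c (-ε) v) v e γ y := by
  have cutoff_neg : cutoff ℓ c (-ε) v = fun y => cutoff ℓ c 0 v y - ε :=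
    funext fun y => by simp [cutoff, sub_eq_add_neg]
  have hvAt : ∀ y ∈ V, ContDiffAt ℝ 2 v y := fun y hy => hv.contDiffAt (hV.mem_nhds hy)
  have factor_cont : ContinuousOn (fun y => dirDeriv e (dirDeriv e v) y *
      Real.exp (γ / 2 * dirDeriv e v y ^ 2)) V := fun y hy => by
    have hev : ContDiffAt ℝ 1 (dirDeriv e v) y := contDiffAt_dirDeriv (hvAt y hy) (by norm_num) e
    have heev : ContDiffAt ℝ 0 (dirDeriv e (dirDeriv e v)) y :=
      contDiffAt_dirDeriv hev (by norm_num) e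
    exact (heev.continuousAt.mul
      (continuousAt_const.mul (hev.continuousAt.pow 2)).rexp).continuousWithinAt
  obtain ⟨y, hy, hεy, hmax, hzy⟩ := exists_isLocalMax_sub_mul hV
    (fun y hy => (contDiffAt_cutoff (hvAt y hy) ℓ c 0).continuousAt.continuousWithinAt)
    factor_cont (fun y hy => mul_pos (hve y hy) (Real.exp_pos _)) hK hz hεz
  rw [cutoff_neg]
  exact ⟨y, hy, sub_pos.2 hεy, hmax, hzy⟩

theorem exists_pogorelov_bound {n : ℕ} {b : Fin (n + 1) → E} {d : E} {ℓ : E →L[ℝ] ℝ} {β : ℝ}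
    (hℓb : ℓ (b 0) = 0) (hℓd : ℓ d = -1) (hβ : n < β) (c M₁ M₂ : ℝ) :
    ∃ C : ℝ, ∀ (V : Set E) (v f : E → ℝ), IsOpen V → ContDiffOn ℝ 4 v V →
      (∀ y ∈ V, (frameHessian b v y).PosDef) → (∀ y ∈ V, dirDeriv d v y < 0) →
      (∀ y ∈ V, 0 < f y) → (∀ y, ∀ t : ℝ, f (y + t • b 0) = f y) →
      (∀ y ∈ V, (frameHessian b v y).det = f y * (-dirDeriv d v y) ^ β) →
      (∀ y ∈ V, -M₁ ≤ 1 / dirDeriv d v y) → (∀ y ∈ V, |dirDeriv (b 0) v y| ≤ M₂) →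
      (∀ ε > 0, IsCompact {y ∈ V | ε ≤ cutoff ℓ c 0 v y}) →
      ∀ y ∈ V, cutoff ℓ c 0 v y * dirDeriv (b 0) (dirDeriv (b 0) v) y ≤ C := by
  obtain ⟨γ, K, hγ, hK, bound⟩ := exists_bound_of_inequality (c * (n + 1 - β)) M₁ M₂ c
    (n.cast_nonneg.trans_lt hβ) (sub_pos.2 hβ)
  refine ⟨2 * (K * Real.exp (γ / 2 * M₂ ^ 2)), fun V v f hV hv hposDef hd hf hf_line hdet hM₁ hM₂
    hcompact z hz => ?_⟩
  have hve_pos : ∀ y ∈ V, 0 < dirDeriv (b 0) (dirDeriv (b 0) v) y :=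
    fun y hy => (hposDef y hy).diag_pos
  rcases le_or_gt (cutoff ℓ c 0 v z) 0 with hz0 | hz0
  · exact (mul_nonpos_of_nonpos_of_nonneg hz0 (hve_pos z hz).le).trans (by positivity)
  set ε := cutoff ℓ c 0 v z / 2
  obtain ⟨y, hy, hw, hmax, hzy⟩ := exists_isLocalMax_pogorelov γ hV (hv.of_le (by norm_num))
    hve_pos (hcompact ε (half_pos hz0)) hz (half_lt_self hz0)
  have hdet_line : ∀ᶠ t in 𝓝 (0 : ℝ), (frameHessian b v (y + t • b 0)).det =
      f y * (-dirDeriv d v (y + t • b 0)) ^ β :=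
    ((tendsto_line y (b 0)).eventually (hV.mem_nhds hy)).mono
      fun t ht => by rw [hdet _ ht, hf_line]
  have at_max : cutoff ℓ c (-ε) v y * dirDeriv (b 0) (dirDeriv (b 0) v) y ≤ K :=
    bound _ _ _ _ hw (hve_pos y hy) (hM₂ y hy) (hM₁ y hy)
      (inequality_of_isLocalMax_pogorelov_of_posDef (hv.contDiffAt (hV.mem_nhds hy)) (hposDef y hy)
        (hd y hy) hℓb hℓd hβ (hf y hy) hdet_line hw hmax)
  have pogorelov_le :
      pogorelov (cutoff ℓ c (-ε) v) v (b 0) γ y ≤ K * Real.exp (γ / 2 * M₂ ^ 2) := by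
    have := sq_le_sq.2 ((hM₂ y hy).trans (le_abs_self M₂))
    rw [pogorelov, ← mul_assoc]
    gcongr
  have le_pogorelov : ε * dirDeriv (b 0) (dirDeriv (b 0) v) z ≤
      pogorelov (cutoff ℓ c (-ε) v) v (b 0) γ z := by
    have cutoff_z : cutoff ℓ c (-ε) v z = ε := by simp only [ε, cutoff]; ring
    rw [pogorelov, cutoff_z]
    gcongr
    exact le_mul_of_one_le_right (hve_pos z hz).le (Real.one_le_exp (by positivity))
  calc cutoff ℓ c 0 v z * dirDeriv (b 0) (dirDeriv (b 0) v) z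
      = 2 * (ε * dirDeriv (b 0) (dirDeriv (b 0) v) z) := by simp only [ε]; ring
    _ ≤ 2 * (K * Real.exp (γ / 2 * M₂ ^ 2)) := by linarith

end Estimate

section SetLast

variable {k : ℕ} (x y : EuclideanSpace ℝ (Fin (k + 1))) (s t : ℝ)

@[simp]
theorem setLast_last : setLast x s (Fin.last k) = s := by simp [setLast]

theorem setLast_of_ne {i : Fin (k + 1)} (hi : i ≠ Fin.last k) : setLast x s i = x i := by
  simp [setLast, hi]

@[simp]
theorem setLast_setLast : setLast (setLast x s) t = setLast x t := by simp [setLast]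

@[simp]
theorem setLast_self : setLast x (x (Fin.last k)) = x := by
  ext i
  simp [setLast]

theorem setLast_eq_add :
    setLast x s = x + (s - x (Fin.last k)) • EuclideanSpace.single (Fin.last k) (1 : ℝ) := by
  ext i
  by_cases hi : i = Fin.last k
  · simp [hi]
  · simp [setLast_of_ne x s hi, hi]

variable (k)

theorem setLast_zero :
    setLast (0 : EuclideanSpace ℝ (Fin (k + 1))) s = s • EuclideanSpace.single (Fin.last k) 1 := by
  simp [setLast_eq_add]

theorem setLast_single_last :
    setLast (EuclideanSpace.single (Fin.last k) 1) s =
      s • EuclideanSpace.single (Fin.last k) (1 : ℝ) := by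
  simp [setLast_eq_add, sub_smul]

/-- `setLast` as a continuous linear map in both arguments jointly. -/
noncomputable def setLastL :
    EuclideanSpace ℝ (Fin (k + 1)) × ℝ →L[ℝ] EuclideanSpace ℝ (Fin (k + 1)) :=
  .fst ℝ _ ℝ + (.snd ℝ _ ℝ - (EuclideanSpace.proj (Fin.last k)).comp (.fst ℝ _ ℝ)).smulRight
    (EuclideanSpace.single (Fin.last k) 1)

variable {k}

theorem setLastL_apply : setLastL k (x, s) = setLast x s := by
  simp [setLastL, setLast_eq_add]

variable {x y s t}

theorem middle_setLast {m : ℕ} (x : EuclideanSpace ℝ (Fin (m + 2))) (s : ℝ) :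
    middle (setLast x s) = middle x :=
  funext fun i => setLast_of_ne x s (Fin.castSucc_lt_last i.succ).ne

theorem middle_add_smul_single_zero {m : ℕ} (x : EuclideanSpace ℝ (Fin (m + 2))) (t : ℝ) :
    middle (x + t • EuclideanSpace.single 0 1) = middle x :=
  funext fun i => by simp [middle]

theorem contDiffAt_setLast {u : EuclideanSpace ℝ (Fin (k + 1)) → ℝ} {r : WithTop ℕ∞}
    (hu : ContDiffAt ℝ r u x) : ContDiffAt ℝ r (fun y => setLast y (u y)) x := by
  simp only [← setLastL_apply]
  exact (setLastL k).contDiff.contDiffAt.comp x (contDiffAt_id.prodMk hu)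

theorem hasFDerivAt_setLast {u : EuclideanSpace ℝ (Fin (k + 1)) → ℝ}
    {u' : EuclideanSpace ℝ (Fin (k + 1)) →L[ℝ] ℝ} (hu : HasFDerivAt u u' x) :
    HasFDerivAt (fun y => setLast y (u y)) (setLastL k ∘L (.prod (.id ℝ _) u')) x := by
  simp only [← setLastL_apply]
  exact (setLastL k).hasFDerivAt.comp x ((hasFDerivAt_id x).prodMk hu)

end SetLast

section LevelGraph

variable {k : ℕ} {Ω : Set (EuclideanSpace ℝ (Fin (k + 1)))}
  {u : EuclideanSpace ℝ (Fin (k + 1)) → ℝ} {x : EuclideanSpace ℝ (Fin (k + 1))}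

theorem levelGraph_setLast (hinc : IncreasingInLast Ω u) (hx : x ∈ Ω) :
    levelGraph Ω u (setLast x (u x)) = -x (Fin.last k) := by
  have strictMono {s t : ℝ} (hs : setLast x s ∈ Ω) (ht : setLast x t ∈ Ω) (hst : s < t) :
      u (setLast x s) < u (setLast x t) := by
    simpa using hinc _ hs t (by simpa using hst) (by simpa using ht)
  have singleton : {t : ℝ | setLast (setLast x (u x)) t ∈ Ω ∧
      u (setLast (setLast x (u x)) t) = setLast x (u x) (Fin.last k)} = {x (Fin.last k)} := by
    ext t
    simp only [setLast_setLast, setLast_last, Set.mem_ofPred_eq, Set.mem_singleton_iff]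
    refine ⟨fun ⟨ht, hut⟩ => ?_, fun ht => by simp [ht, hx]⟩
    have hx' : setLast x (x (Fin.last k)) ∈ Ω := by simpa using hx
    rcases lt_trichotomy t (x (Fin.last k)) with h | h | h
    · exact absurd (strictMono ht hx' h) (by simp [hut])
    · exact h
    · exact absurd (strictMono hx' ht h) (by simp [hut])
  rw [levelGraph, singleton, csInf_singleton]

theorem setLast_neg_levelGraph (hinc : IncreasingInLast Ω u) (hx : x ∈ Ω) :
    setLast (setLast x (u x)) (-levelGraph Ω u (setLast x (u x))) = x := by
  simp [levelGraph_setLast hinc hx]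

theorem partialDeriv_last_pos (hΩ : IsOpen Ω) (hu : DifferentiableOn ℝ u Ω) (hc : ConvexOn ℝ Ω u)
    (hinc : IncreasingInLast Ω u) (hx : x ∈ Ω) : 0 < partialDeriv (Fin.last k) u x := by
  set e : EuclideanSpace ℝ (Fin (k + 1)) := EuclideanSpace.single (Fin.last k) 1
  let L : ℝ →ᵃ[ℝ] EuclideanSpace ℝ (Fin (k + 1)) := AffineMap.lineMap x (x + e)
  have hL (t : ℝ) : L t = x + t • e := by simp [L, AffineMap.lineMap_apply, add_comm]
  have hL_setLast (t : ℝ) : L t = setLast x (x (Fin.last k) + t) := by simp [hL, setLast_eq_add, e]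
  have hderiv : HasDerivAt (u ∘ L) (partialDeriv (Fin.last k) u x) 0 := by
    have : HasDerivAt (fun t : ℝ => u (x + t • e)) (partialDeriv (Fin.last k) u x) 0 :=
      hasDerivAt_line_zero (hu.differentiableAt (hΩ.mem_nhds hx)) e
    simpa only [Function.comp_def, hL] using this
  obtain ⟨s, hsΩ, hs⟩ : ∃ s : ℝ, L s ∈ Ω ∧ s < 0 := by
    have near : ∀ᶠ s in 𝓝 (0 : ℝ), L s ∈ Ω := by
      have : ∀ᶠ s in 𝓝 (0 : ℝ), x + s • e ∈ Ω := (tendsto_line x e).eventually (hΩ.mem_nhds hx)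
      simpa only [hL] using this
    exact ((near.filter_mono nhdsWithin_le_nhds).and (self_mem_nhdsWithin (s := Set.Iio 0))).exists
  have hlt : u (L s) < u (L 0) := by
    rw [hL_setLast s] at hsΩ ⊢
    simpa [hL] using hinc _ hsΩ (x (Fin.last k)) (by simpa using hs) (by simpa using hx)
  have slope_le := (hc.comp_affineMap L).slope_le_of_hasDerivAt hsΩ (by simpa [hL] using hx) hs
    hderiv
  refine lt_of_lt_of_le ?_ slope_le
  rw [slope_def_field]
  exact div_pos (sub_pos.2 hlt) (by linarith)

theorem exists_equiv_hasFDerivAt_setLast (hu : DifferentiableAt ℝ u x)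
    (hne : partialDeriv (Fin.last k) u x ≠ 0) :
    ∃ Φ' : EuclideanSpace ℝ (Fin (k + 1)) ≃L[ℝ] EuclideanSpace ℝ (Fin (k + 1)),
      HasFDerivAt (fun y => setLast y (u y))
        (Φ' : EuclideanSpace ℝ (Fin (k + 1)) →L[ℝ] EuclideanSpace ℝ (Fin (k + 1))) x := by
  set L := setLastL k ∘L (.prod (.id ℝ _) (fderiv ℝ u x))
  have L_apply (a : EuclideanSpace ℝ (Fin (k + 1))) : L a = setLast a (fderiv ℝ u x a) :=
    setLastL_apply _ _
  have injective : Function.Injective L := by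
    refine (injective_iff_map_eq_zero L).2 fun a ha => ?_
    rw [L_apply] at ha
    have a_eq : a = a (Fin.last k) • EuclideanSpace.single (Fin.last k) 1 := by
      ext i
      by_cases hi : i = Fin.last k
      · simp [hi]
      · simpa [setLast_of_ne _ _ hi, hi] using congrFun (congrArg WithLp.ofLp ha) i
    have ua_zero : fderiv ℝ u x a = 0 := by
      simpa using congrFun (congrArg WithLp.ofLp ha) (Fin.last k)
    rw [a_eq, map_smul, ← dirDeriv_eq_fderiv hu, smul_eq_mul] at ua_zero
    rw [a_eq, (mul_eq_zero.1 ua_zero).resolve_right hne, zero_smul]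
  exact ⟨(LinearEquiv.ofInjectiveEndo L.toLinearMap injective).toContinuousLinearEquiv,
    hasFDerivAt_setLast hu.hasFDerivAt⟩

theorem exists_localInverse_setLast {r : WithTop ℕ∞} (hr : r ≠ 0) (hu : ContDiffAt ℝ r u x)
    (hΩ : Ω ∈ 𝓝 x) (hne : partialDeriv (Fin.last k) u x ≠ 0) :
    ∃ g : EuclideanSpace ℝ (Fin (k + 1)) → EuclideanSpace ℝ (Fin (k + 1)),
      ContDiffAt ℝ r g (setLast x (u x)) ∧
        ∀ᶠ y in 𝓝 (setLast x (u x)), g y ∈ Ω ∧ setLast (g y) (u (g y)) = y := by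
  obtain ⟨Φ', hΦ'⟩ := exists_equiv_hasFDerivAt_setLast (hu.differentiableAt hr) hne
  have hΦ := contDiffAt_setLast hu
  have image : hΦ.localInverse hΦ' hr (setLast x (u x)) = x :=
    hΦ.localInverse_apply_image hΦ' hr
  have smooth : ContDiffAt ℝ r (hΦ.localInverse hΦ' hr) (setLast x (u x)) :=
    hΦ.to_localInverse hΦ' hr
  exact ⟨hΦ.localInverse hΦ' hr, smooth,
    (smooth.continuousAt.eventually_mem (by rwa [image])).and
      (hΦ.hasStrictFDerivAt' hΦ' hr).eventually_right_inverse⟩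

theorem contDiffAt_levelGraph {r : WithTop ℕ∞} (hr : r ≠ 0) (hu : ContDiffAt ℝ r u x)
    (hinc : IncreasingInLast Ω u) (hΩ : Ω ∈ 𝓝 x) (hne : partialDeriv (Fin.last k) u x ≠ 0) :
    ContDiffAt ℝ r (levelGraph Ω u) (setLast x (u x)) := by
  obtain ⟨g, hg, hright⟩ := exists_localInverse_setLast hr hu hΩ hne
  have hlast : ContDiff ℝ r fun z : EuclideanSpace ℝ (Fin (k + 1)) => -z (Fin.last k) := by fun_prop
  refine (hlast.contDiffAt.comp _ hg).congr_of_eventuallyEq ?_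
  filter_upwards [hright] with y ⟨hy, hgy⟩
  simpa [hgy] using levelGraph_setLast hinc hy

/-- The set of the points `(x', u(x))`, `x ∈ Ω`, on which the graph function of the level sets has
its meaning. -/
def levelGraphDomain (Ω : Set (EuclideanSpace ℝ (Fin (k + 1))))
    (u : EuclideanSpace ℝ (Fin (k + 1)) → ℝ) : Set (EuclideanSpace ℝ (Fin (k + 1))) :=
  (fun x => setLast x (u x)) '' Ω

theorem isOpen_levelGraphDomain (hΩ : IsOpen Ω) (hu : ContDiffOn ℝ 1 u Ω)
    (hne : ∀ x ∈ Ω, partialDeriv (Fin.last k) u x ≠ 0) : IsOpen (levelGraphDomain Ω u) := by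
  refine isOpen_iff_mem_nhds.2 (Set.forall_mem_image.2 fun x hx => ?_)
  obtain ⟨g, -, hright⟩ := exists_localInverse_setLast one_ne_zero
    (hu.contDiffAt (hΩ.mem_nhds hx)) (hΩ.mem_nhds hx) (hne x hx)
  filter_upwards [hright] with y ⟨hy, hgy⟩ using ⟨g y, hy, hgy⟩

end LevelGraph

section Graph

variable {k : ℕ} {u v : EuclideanSpace ℝ (Fin (k + 1)) → ℝ} {y : EuclideanSpace ℝ (Fin (k + 1))}

theorem hasDerivAt_setLast {c : ℝ → EuclideanSpace ℝ (Fin (k + 1))} {φ : ℝ → ℝ}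
    {c' : EuclideanSpace ℝ (Fin (k + 1))} {φ' t : ℝ} (hc : HasDerivAt c c' t)
    (hφ : HasDerivAt φ φ' t) : HasDerivAt (fun s => setLast (c s) (φ s)) (setLast c' φ') t := by
  simp only [← setLastL_apply]
  exact (setLastL k).hasFDerivAt.comp_hasDerivAt t (hc.prodMk hφ)

theorem hasDerivAt_setLast_neg_line (hv : DifferentiableAt ℝ v y)
    (b : EuclideanSpace ℝ (Fin (k + 1))) :
    HasDerivAt (fun t : ℝ => setLast (y + t • b) (-v (y + t • b)))
      (setLast b (-dirDeriv b v y)) 0 :=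
  hasDerivAt_setLast (by simpa using ((hasDerivAt_id (0 : ℝ)).smul_const b).const_add y)
    (hasDerivAt_line_zero hv b).neg

theorem fderiv_setLast_neg_dirDeriv (hu : DifferentiableAt ℝ u (setLast y (-v y)))
    (hv : DifferentiableAt ℝ v y)
    (huv : ∀ᶠ z in 𝓝 y, u (setLast z (-v z)) = z (Fin.last k))
    (a : EuclideanSpace ℝ (Fin (k + 1))) :
    fderiv ℝ u (setLast y (-v y)) (setLast a (-dirDeriv a v y)) = a (Fin.last k) := by
  have chain : HasDerivAt (fun t : ℝ => u (setLast (y + t • a) (-v (y + t • a))))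
      (fderiv ℝ u (setLast y (-v y)) (setLast a (-dirDeriv a v y))) 0 :=
    HasFDerivAt.comp_hasDerivAt 0 (by simpa using hu.hasFDerivAt)
      (hasDerivAt_setLast_neg_line hv a)
  have last_coord : HasDerivAt (fun t : ℝ => (y + t • a) (Fin.last k)) (a (Fin.last k)) 0 := by
    simpa using ((hasDerivAt_id (0 : ℝ)).mul_const (a (Fin.last k))).const_add (y (Fin.last k))
  exact chain.unique (last_coord.congr_of_eventuallyEq ((tendsto_line y a).eventually huv))

theorem neg_partialDeriv_mul_partialDeriv_last (hu : DifferentiableAt ℝ u (setLast y (-v y)))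
    (hv : DifferentiableAt ℝ v y)
    (huv : ∀ᶠ z in 𝓝 y, u (setLast z (-v z)) = z (Fin.last k)) :
    -partialDeriv (Fin.last k) v y * partialDeriv (Fin.last k) u (setLast y (-v y)) = 1 := by
  have := fderiv_setLast_neg_dirDeriv hu hv huv (EuclideanSpace.single (Fin.last k) 1)
  rw [setLast_single_last, map_smul, ← dirDeriv_eq_fderiv hu] at this
  exact this.trans (by simp)

theorem hasDerivAt_fderiv_setLast_neg_dirDeriv (hu : ContDiffAt ℝ 2 u (setLast y (-v y)))
    (hv : ContDiffAt ℝ 2 v y) (a b : EuclideanSpace ℝ (Fin (k + 1))) :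
    HasDerivAt (fun t : ℝ => fderiv ℝ u (setLast (y + t • b) (-v (y + t • b)))
        (setLast a (-dirDeriv a v (y + t • b))))
      (fderiv ℝ (fderiv ℝ u) (setLast y (-v y)) (setLast b (-dirDeriv b v y))
          (setLast a (-dirDeriv a v y))
        - partialDeriv (Fin.last k) u (setLast y (-v y)) * dirDeriv b (dirDeriv a v) y) 0 := by
  have hav : DifferentiableAt ℝ (dirDeriv a v) y :=
    (contDiffAt_dirDeriv hv (l := 1) (by norm_num) a).differentiableAt one_ne_zero
  have hu' : DifferentiableAt ℝ (fderiv ℝ u) (setLast y (-v y)) :=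
    (hu.fderiv_right (m := 1) (by norm_num)).differentiableAt one_ne_zero
  have outer : HasDerivAt (fun t : ℝ => fderiv ℝ u (setLast (y + t • b) (-v (y + t • b))))
      (fderiv ℝ (fderiv ℝ u) (setLast y (-v y)) (setLast b (-dirDeriv b v y))) 0 :=
    HasFDerivAt.comp_hasDerivAt 0 (by simpa using hu'.hasFDerivAt)
      (hasDerivAt_setLast_neg_line (hv.differentiableAt two_ne_zero) b)
  have inner := hasDerivAt_setLast (hasDerivAt_const 0 a) (hasDerivAt_line_zero hav b).neg
  have vertical : fderiv ℝ u (setLast y (-v y)) (setLast 0 (-dirDeriv b (dirDeriv a v) y)) =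
      -(partialDeriv (Fin.last k) u (setLast y (-v y)) * dirDeriv b (dirDeriv a v) y) := by
    rw [setLast_zero, map_smul, ← dirDeriv_eq_fderiv (hu.differentiableAt two_ne_zero), smul_eq_mul,
      neg_mul, mul_comm]
    rfl
  rw [sub_eq_add_neg, ← vertical]
  simpa using outer.clm_apply inner

theorem fderiv_fderiv_setLast_neg_dirDeriv (hu : ContDiffAt ℝ 2 u (setLast y (-v y)))
    (hv : ContDiffAt ℝ 2 v y) (huv : ∀ᶠ z in 𝓝 y, u (setLast z (-v z)) = z (Fin.last k))
    (a b : EuclideanSpace ℝ (Fin (k + 1))) :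
    fderiv ℝ (fderiv ℝ u) (setLast y (-v y)) (setLast b (-dirDeriv b v y))
        (setLast a (-dirDeriv a v y)) =
      partialDeriv (Fin.last k) u (setLast y (-v y)) * dirDeriv b (dirDeriv a v) y := by
  have first : ∀ᶠ z in 𝓝 y, fderiv ℝ u (setLast z (-v z)) (setLast a (-dirDeriv a v z)) =
      a (Fin.last k) := by
    have continuousAt : ContinuousAt (fun z => setLast z (-v z)) y :=
      (contDiffAt_setLast hv.neg).continuousAt
    filter_upwards [continuousAt.eventually (eventually_differentiableAt hu one_le_two),
      eventually_differentiableAt hv one_le_two, huv.eventually_nhds] with z huz hvz huvz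
      using fderiv_setLast_neg_dirDeriv huz hvz huvz a
  exact sub_eq_zero.1 <| (hasDerivAt_fderiv_setLast_neg_dirDeriv hu hv a b).unique <|
    (hasDerivAt_const 0 (a (Fin.last k))).congr_of_eventuallyEq
      ((tendsto_line y b).eventually first)

/-- The Jacobian matrix of the map `(x', s) ↦ (x', -v(x', s))` at `y`. -/
noncomputable def graphMatrix (v : EuclideanSpace ℝ (Fin (k + 1)) → ℝ)
    (y : EuclideanSpace ℝ (Fin (k + 1))) : Matrix (Fin (k + 1)) (Fin (k + 1)) ℝ :=
  of fun i j => setLast (EuclideanSpace.single j 1) (-partialDeriv j v y) i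

theorem det_graphMatrix (v : EuclideanSpace ℝ (Fin (k + 1)) → ℝ)
    (y : EuclideanSpace ℝ (Fin (k + 1))) :
    (graphMatrix v y).det = -partialDeriv (Fin.last k) v y := by
  have eq_updateRow : graphMatrix v y =
      (1 : Matrix _ _ ℝ)ᵀ.updateRow (Fin.last k) fun j => -partialDeriv j v y := by
    ext i j
    by_cases hi : i = Fin.last k
    · simp [graphMatrix, hi]
    · simp [graphMatrix, hi, setLast_of_ne _ _ hi, one_apply]
  rw [eq_updateRow, transpose_one, ← transpose_one, ← cramer_transpose_apply]
  simp

theorem smul_hessian_eq (hu : ContDiffAt ℝ 2 u (setLast y (-v y))) (hv : ContDiffAt ℝ 2 v y)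
    (huv : ∀ᶠ z in 𝓝 y, u (setLast z (-v z)) = z (Fin.last k)) :
    partialDeriv (Fin.last k) u (setLast y (-v y)) • hessian v y =
      (graphMatrix v y)ᵀ * hessian u (setLast y (-v y)) * graphMatrix v y := by
  have columns : (fun j => ∑ i, graphMatrix v y i j • EuclideanSpace.single i (1 : ℝ)) =
      fun j => setLast (EuclideanSpace.single j 1) (-partialDeriv j v y) := by
    ext j i
    simp [graphMatrix, Pi.single_apply]
  refine Eq.trans ?_ (frameHessian_sum hu (fun i => EuclideanSpace.single i 1) _)
  ext i j
  rw [columns, frameHessian, of_apply, dirDeriv_dirDeriv_eq_fderiv_fderiv hu]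
  exact (fderiv_fderiv_setLast_neg_dirDeriv hu hv huv _ _).symm

end Graph

section Equation

theorem posSemidef_frameHessian {E ι : Type*} [NormedAddCommGroup E] [NormedSpace ℝ E] [Finite ι]
    {V : Set E} {g : E → ℝ} {x : E} (hV : IsOpen V) (hg : ContDiffOn ℝ 2 g V)
    (hc : ConvexOn ℝ V g) (hx : x ∈ V) (b : ι → E) : (frameHessian b g x).PosSemidef := by
  have := Fintype.ofFinite ι
  have hgx := hg.contDiffAt (hV.mem_nhds hx)
  refine .of_dotProduct_mulVec_nonneg (isSymm_frameHessian hgx b) fun c => ?_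
  have entry := congrFun₂ (frameHessian_sum hgx b (of fun i (_ : Unit) => c i)) () ()
  have nonneg := dirDeriv_dirDeriv_nonneg_of_convexOn hV hg hc hx (∑ i, c i • b i)
  rw [Matrix.mul_assoc] at entry
  rw [star_trivial]
  exact nonneg.trans_eq entry

theorem posDef_hessian_of_convexOn {n : ℕ} {Ω : Set (EuclideanSpace ℝ (Fin n))}
    {u : EuclideanSpace ℝ (Fin n) → ℝ} {x : EuclideanSpace ℝ (Fin n)} (hΩ : IsOpen Ω)
    (hu : ContDiffOn ℝ 2 u Ω) (hc : ConvexOn ℝ Ω u) (hx : x ∈ Ω) (hdet : (hessian u x).det ≠ 0) :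
    (hessian u x).PosDef :=
  (posSemidef_frameHessian hΩ hu hc hx
    fun i => EuclideanSpace.single i 1).posDef_iff_det_ne_zero.2 hdet

variable {k : ℕ} {u v : EuclideanSpace ℝ (Fin (k + 1)) → ℝ} {y : EuclideanSpace ℝ (Fin (k + 1))}

theorem posDef_hessian_graph (hu : ContDiffAt ℝ 2 u (setLast y (-v y)))
    (hv : ContDiffAt ℝ 2 v y) (huv : ∀ᶠ z in 𝓝 y, u (setLast z (-v z)) = z (Fin.last k))
    (hpos : 0 < partialDeriv (Fin.last k) u (setLast y (-v y)))
    (hposDef : (hessian u (setLast y (-v y))).PosDef) : (hessian v y).PosDef := by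
  have det_ne : (graphMatrix v y).det ≠ 0 := by
    rw [det_graphMatrix]
    exact left_ne_zero_of_mul_eq_one (neg_partialDeriv_mul_partialDeriv_last
      (hu.differentiableAt two_ne_zero) (hv.differentiableAt two_ne_zero) huv)
  have congruent := hposDef.conjTranspose_mul_mul_same (B := graphMatrix v y)
    (mulVec_injective_iff_isUnit.2 ((isUnit_iff_isUnit_det _).2 det_ne.isUnit))
  rw [conjTranspose_eq_transpose_of_trivial, ← smul_hessian_eq hu hv huv] at congruent
  simpa [smul_smul, hpos.ne'] using congruent.smul (inv_pos.2 hpos)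

theorem det_hessian_graph {α : ℝ} (hu : ContDiffAt ℝ 2 u (setLast y (-v y)))
    (hv : ContDiffAt ℝ 2 v y) (huv : ∀ᶠ z in 𝓝 y, u (setLast z (-v z)) = z (Fin.last k))
    (hpos : 0 < partialDeriv (Fin.last k) u (setLast y (-v y))) :
    (hessian v y).det = partialDeriv (Fin.last k) u (setLast y (-v y)) ^ α *
      (hessian u (setLast y (-v y))).det * (-partialDeriv (Fin.last k) v y) ^ (k + 3 + α) := by
  have det_eq := congrArg det (smul_hessian_eq hu hv huv)
  rw [det_smul, det_mul, det_mul, det_transpose, det_graphMatrix, Fintype.card_fin] at det_eq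
  have reciprocal := neg_partialDeriv_mul_partialDeriv_last
    (hu.differentiableAt two_ne_zero) (hv.differentiableAt two_ne_zero) huv
  set r := partialDeriv (Fin.last k) u (setLast y (-v y))
  set q := -partialDeriv (Fin.last k) v y
  have hq : 0 < q := pos_of_mul_pos_left (reciprocal ▸ one_pos) hpos.le
  have rpow_reciprocal : r ^ α * q ^ α = 1 := by
    rw [← Real.mul_rpow hpos.le hq.le, mul_comm, reciprocal, Real.one_rpow]
  have pow_reciprocal : r ^ (k + 1) * q ^ (k + 1) = 1 := by
    rw [← mul_pow, mul_comm, reciprocal, one_pow]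
  calc (hessian v y).det = q ^ (k + 1) * (r ^ (k + 1) * (hessian v y).det) := by
        linear_combination (-(hessian v y).det) * pow_reciprocal
    _ = (hessian u (setLast y (-v y))).det * q ^ (k + 3) := by rw [det_eq]; ring
    _ = r ^ α * (hessian u (setLast y (-v y))).det * (q ^ (k + 3) * q ^ α) := by
        linear_combination
          (-(hessian u (setLast y (-v y))).det * q ^ (k + 3)) * rpow_reciprocal
    _ = _ := by rw [← Real.rpow_natCast, ← Real.rpow_add hq]; push_cast; rfl

end Equation

section LevelGraphEquation

variable {k : ℕ} {Ω : Set (EuclideanSpace ℝ (Fin (k + 1)))}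
  {u : EuclideanSpace ℝ (Fin (k + 1)) → ℝ} {x : EuclideanSpace ℝ (Fin (k + 1))}

theorem eventually_apply_setLast_neg_levelGraph (hu : ContDiffAt ℝ 2 u x)
    (hinc : IncreasingInLast Ω u) (hΩ : Ω ∈ 𝓝 x) (hne : partialDeriv (Fin.last k) u x ≠ 0) :
    ∀ᶠ y in 𝓝 (setLast x (u x)), u (setLast y (-levelGraph Ω u y)) = y (Fin.last k) := by
  obtain ⟨g, -, hg⟩ := exists_localInverse_setLast two_ne_zero hu hΩ hne
  filter_upwards [hg] with y ⟨hy, hgy⟩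
  rw [← hgy, setLast_neg_levelGraph hinc hy, setLast_last]

theorem neg_partialDeriv_levelGraph_mul_partialDeriv (hu : ContDiffAt ℝ 2 u x)
    (hinc : IncreasingInLast Ω u) (hΩ : Ω ∈ 𝓝 x) (hne : partialDeriv (Fin.last k) u x ≠ 0) :
    -partialDeriv (Fin.last k) (levelGraph Ω u) (setLast x (u x)) *
      partialDeriv (Fin.last k) u x = 1 := by
  have hv := contDiffAt_levelGraph two_ne_zero hu hinc hΩ hne
  have huv := eventually_apply_setLast_neg_levelGraph hu hinc hΩ hne
  have inverse := setLast_neg_levelGraph hinc (mem_of_mem_nhds hΩ)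
  have := neg_partialDeriv_mul_partialDeriv_last
    (by rw [inverse]; exact hu.differentiableAt two_ne_zero) (hv.differentiableAt two_ne_zero) huv
  rwa [inverse] at this

theorem partialDeriv_levelGraph_neg (hu : ContDiffAt ℝ 2 u x) (hinc : IncreasingInLast Ω u)
    (hΩ : Ω ∈ 𝓝 x) (hpos : 0 < partialDeriv (Fin.last k) u x) :
    partialDeriv (Fin.last k) (levelGraph Ω u) (setLast x (u x)) < 0 :=
  neg_pos.1 <| pos_of_mul_pos_left (one_pos.trans_eq
    (neg_partialDeriv_levelGraph_mul_partialDeriv hu hinc hΩ hpos.ne').symm) hpos.le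

theorem one_div_partialDeriv_levelGraph (hu : ContDiffAt ℝ 2 u x) (hinc : IncreasingInLast Ω u)
    (hΩ : Ω ∈ 𝓝 x) (hne : partialDeriv (Fin.last k) u x ≠ 0) :
    1 / partialDeriv (Fin.last k) (levelGraph Ω u) (setLast x (u x)) =
      -partialDeriv (Fin.last k) u x := by
  have reciprocal := neg_partialDeriv_levelGraph_mul_partialDeriv hu hinc hΩ hne
  rw [neg_mul, ← mul_neg] at reciprocal
  rw [one_div, inv_eq_of_mul_eq_one_right reciprocal]

theorem posDef_hessian_levelGraph (hu : ContDiffAt ℝ 2 u x) (hinc : IncreasingInLast Ω u)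
    (hΩ : Ω ∈ 𝓝 x) (hpos : 0 < partialDeriv (Fin.last k) u x) (hposDef : (hessian u x).PosDef) :
    (hessian (levelGraph Ω u) (setLast x (u x))).PosDef := by
  have inverse := setLast_neg_levelGraph hinc (mem_of_mem_nhds hΩ)
  exact posDef_hessian_graph (by rwa [inverse])
    (contDiffAt_levelGraph two_ne_zero hu hinc hΩ hpos.ne')
    (eventually_apply_setLast_neg_levelGraph hu hinc hΩ hpos.ne') (by rwa [inverse])
    (by rwa [inverse])

theorem det_hessian_levelGraph (α : ℝ) (hu : ContDiffAt ℝ 2 u x) (hinc : IncreasingInLast Ω u)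
    (hΩ : Ω ∈ 𝓝 x) (hpos : 0 < partialDeriv (Fin.last k) u x) :
    (hessian (levelGraph Ω u) (setLast x (u x))).det =
      partialDeriv (Fin.last k) u x ^ α * (hessian u x).det *
        (-partialDeriv (Fin.last k) (levelGraph Ω u) (setLast x (u x))) ^ (k + 3 + α) := by
  have inverse := setLast_neg_levelGraph hinc (mem_of_mem_nhds hΩ)
  have := det_hessian_graph (α := α) (by rwa [inverse])
    (contDiffAt_levelGraph two_ne_zero hu hinc hΩ hpos.ne')
    (eventually_apply_setLast_neg_levelGraph hu hinc hΩ hpos.ne') (by rwa [inverse])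
  rwa [inverse] at this

theorem cutoff_levelGraph (σ : ℝ) (hinc : IncreasingInLast Ω u) (hx : x ∈ Ω) :
    cutoff (-EuclideanSpace.proj (Fin.last k)) (-σ) 0 (levelGraph Ω u) (setLast x (u x)) =
      σ * x (Fin.last k) - u x := by
  simp only [cutoff, levelGraph_setLast hinc hx, _root_.neg_apply, PiLp.proj_apply, setLast_last]
  ring

theorem isCompact_sep_levelGraphDomain {σ ε : ℝ} (hΩ : IsOpen Ω) (hb : Bornology.IsBounded Ω)
    (hu : ContDiffOn ℝ 0 u Ω) (hcont : ContinuousOn u (closure Ω)) (hinc : IncreasingInLast Ω u)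
    (hbd : ∀ x ∈ frontier Ω, u x = σ * x (Fin.last k)) (hε : 0 < ε) :
    IsCompact {y ∈ levelGraphDomain Ω u |
      ε ≤ cutoff (-EuclideanSpace.proj (Fin.last k)) (-σ) 0 (levelGraph Ω u) y} := by
  have compact : IsCompact {x ∈ Ω | ε ≤ σ * x (Fin.last k) - u x} :=
    isCompact_sep_le hΩ hb (ContinuousOn.sub (by fun_prop) hcont) fun x hx => by
      rwa [hbd x hx, sub_self]
  have image_eq : {y ∈ levelGraphDomain Ω u |
        ε ≤ cutoff (-EuclideanSpace.proj (Fin.last k)) (-σ) 0 (levelGraph Ω u) y} =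
      (fun x => setLast x (u x)) '' {x ∈ Ω | ε ≤ σ * x (Fin.last k) - u x} := by
    ext y
    constructor
    · rintro ⟨⟨x, hx, rfl⟩, hεx⟩
      exact ⟨x, ⟨hx, hεx.trans_eq (cutoff_levelGraph σ hinc hx)⟩, rfl⟩
    · rintro ⟨x, ⟨hx, hεx⟩, rfl⟩
      exact ⟨⟨x, hx, rfl⟩, hεx.trans_eq (cutoff_levelGraph σ hinc hx).symm⟩
  rw [image_eq]
  refine compact.image_of_continuousOn fun x hx => ?_
  exact (contDiffAt_setLast (hu.contDiffAt (hΩ.mem_nhds hx.1))).continuousAt.continuousWithinAt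

end LevelGraphEquation

theorem exists_bound_levelGraph (m : ℕ) {α : ℝ} (hα : -3 < α) (σ M₁ M₂ : ℝ) :
    ∃ C : ℝ, ∀ (Ω : Set (EuclideanSpace ℝ (Fin (m + 2))))
      (u : EuclideanSpace ℝ (Fin (m + 2)) → ℝ) (f : (Fin m → ℝ) → ℝ → ℝ),
      IsOpen Ω → Bornology.IsBounded Ω →
      ContDiffOn ℝ 4 u Ω → ContinuousOn u (closure Ω) → IncreasingInLast Ω u →
      (∀ x ∈ frontier Ω, u x = σ * x (Fin.last (m + 1))) →
      (∀ x ∈ Ω, 0 < partialDeriv (Fin.last (m + 1)) u x) →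
      (∀ x ∈ Ω, (hessian u x).PosDef) →
      (∀ x ∈ Ω, 0 < f (middle x) (u x)) →
      (∀ x ∈ Ω, partialDeriv (Fin.last (m + 1)) u x ^ α * (hessian u x).det =
        f (middle x) (u x)) →
      (∀ x ∈ Ω, partialDeriv (Fin.last (m + 1)) u x ≤ M₁) →
      (∀ x ∈ Ω, |partialDeriv 0 (levelGraph Ω u) (setLast x (u x))| ≤ M₂) →
      ∀ x ∈ Ω, (σ * x (Fin.last (m + 1)) - u x) *
        partialDeriv 0 (partialDeriv 0 (levelGraph Ω u)) (setLast x (u x)) ≤ C := by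
  obtain ⟨C, bound⟩ := exists_pogorelov_bound
    (b := fun i : Fin (m + 2) => EuclideanSpace.single i (1 : ℝ))
    (d := EuclideanSpace.single (Fin.last (m + 1)) 1) (ℓ := -EuclideanSpace.proj (Fin.last (m + 1)))
    (β := (m + 1 : ℕ) + 3 + α) (by simp) (by simp) (by linarith) (-σ) M₁ M₂
  refine ⟨C, fun Ω u f hΩ hb hu hcont hinc hbd hpos hposDef hf heq hM₁ hM₂ x hx => ?_⟩
  have hΩ' : ∀ x ∈ Ω, Ω ∈ 𝓝 x := fun x => hΩ.mem_nhds
  have hu₄ : ∀ x ∈ Ω, ContDiffAt ℝ 4 u x := fun x hx => hu.contDiffAt (hΩ' x hx)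
  have hu₂ : ∀ x ∈ Ω, ContDiffAt ℝ 2 u x := fun x hx => (hu₄ x hx).of_le (by norm_num)
  have equation : ∀ x ∈ Ω, (hessian (levelGraph Ω u) (setLast x (u x))).det =
      f (middle (setLast x (u x))) (setLast x (u x) (Fin.last (m + 1))) *
        (-partialDeriv (Fin.last (m + 1)) (levelGraph Ω u) (setLast x (u x))) ^
          ((m + 1 : ℕ) + 3 + α) := fun x hx => by
    rw [det_hessian_levelGraph α (hu₂ x hx) hinc (hΩ' x hx) (hpos x hx), heq x hx, middle_setLast,
      setLast_last]
  rw [← cutoff_levelGraph σ hinc hx]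
  refine bound (levelGraphDomain Ω u) (levelGraph Ω u)
    (fun y => f (middle y) (y (Fin.last (m + 1))))
    (isOpen_levelGraphDomain hΩ (hu.of_le (by norm_num)) fun x hx => (hpos x hx).ne')
    (Set.forall_mem_image.2 fun x hx => (contDiffAt_levelGraph four_ne_zero (hu₄ x hx) hinc
      (hΩ' x hx) (hpos x hx).ne').contDiffWithinAt)
    (Set.forall_mem_image.2 fun x hx =>
      posDef_hessian_levelGraph (hu₂ x hx) hinc (hΩ' x hx) (hpos x hx) (hposDef x hx))
    (Set.forall_mem_image.2 fun x hx =>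
      partialDeriv_levelGraph_neg (hu₂ x hx) hinc (hΩ' x hx) (hpos x hx))
    (Set.forall_mem_image.2 fun x hx => ?_) (fun y t => by simp [middle_add_smul_single_zero])
    (Set.forall_mem_image.2 equation)
    (Set.forall_mem_image.2 fun x hx => (neg_le_neg (hM₁ x hx)).trans_eq
      (one_div_partialDeriv_levelGraph (hu₂ x hx) hinc (hΩ' x hx) (hpos x hx).ne').symm)
    (Set.forall_mem_image.2 hM₂)
    (fun ε => isCompact_sep_levelGraphDomain hΩ hb (hu.of_le (by norm_num)) hcont hinc hbd)
    _ ⟨x, hx, rfl⟩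
  simpa only [middle_setLast, setLast_last] using hf x hx

end LevelSetEstimate

open LevelSetEstimate

theorem theorem5p2_general (m : ℕ) (α σ : ℝ) (hα : -3 < α) (M₁ M₂ : ℝ) :
    ∃ C : ℝ, ∀ (Ω : Set (EuclideanSpace ℝ (Fin (m + 2))))
      (u : EuclideanSpace ℝ (Fin (m + 2)) → ℝ) (f : (Fin m → ℝ) → ℝ → ℝ),
      IsOpen Ω → Bornology.IsBounded Ω →
      ContDiffOn ℝ 4 u Ω → ContinuousOn u (closure Ω) → ConvexOn ℝ Ω u →
      IncreasingInLast Ω u →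
      (∀ x ∈ frontier Ω, u x = σ * x (Fin.last (m + 1))) →
      (∀ x ∈ Ω, 0 < f (middle x) (u x)) →
      (∀ x ∈ Ω, partialDeriv (Fin.last (m + 1)) u x ^ α * (hessian u x).det =
        f (middle x) (u x)) →
      (∀ x ∈ Ω, partialDeriv (Fin.last (m + 1)) u x ≤ M₁) →
      (∀ x ∈ Ω, |partialDeriv 0 (levelGraph Ω u) (setLast x (u x))| ≤ M₂) →
      ∀ x ∈ Ω, ContDiffAt ℝ 4 (levelGraph Ω u) (setLast x (u x)) ∧
        partialDeriv 0 (partialDeriv 0 (levelGraph Ω u)) (setLast x (u x)) *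
          |u x - σ * x (Fin.last (m + 1))| ≤ C := by
  obtain ⟨C, bound⟩ := exists_bound_levelGraph m hα σ M₁ M₂
  refine ⟨C, fun Ω u f hΩ hb hu hcont hc hinc hbd hf heq hM₁ hM₂ x hx => ?_⟩
  have hpos : ∀ x ∈ Ω, 0 < partialDeriv (Fin.last (m + 1)) u x := fun x hx =>
    partialDeriv_last_pos hΩ (hu.differentiableOn four_ne_zero) hc hinc hx
  have hposDef : ∀ x ∈ Ω, (hessian u x).PosDef := fun x hx =>
    posDef_hessian_of_convexOn hΩ (hu.of_le (by norm_num)) hc hx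
      (right_ne_zero_of_mul ((heq x hx).trans_ne (hf x hx).ne'))
  have below : u x ≤ σ * x (Fin.last (m + 1)) :=
    le_of_le_on_frontier (ℓ := σ • EuclideanSpace.proj (Fin.last (m + 1))) hΩ hb
      (hu.of_le (by norm_num)) hcont (fun x hx => (hposDef x hx).diag_pos (i := 0))
      (fun x hx => (hbd x hx).le) hx
  refine ⟨contDiffAt_levelGraph four_ne_zero (hu.contDiffAt (hΩ.mem_nhds hx)) hinc
    (hΩ.mem_nhds hx) (hpos x hx).ne', ?_⟩
  rw [abs_of_nonpos (sub_nonpos.2 below), neg_sub, mul_comm]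
  exact bound Ω u f hΩ hb hu hcont hinc hbd hpos hposDef hf heq hM₁ hM₂ x hx

theorem theorem5p2 (m : ℕ) (α σ : ℝ) (hα : 0 ≤ α) (hσ : 0 < σ) (M₁ M₂ : ℝ) :
    ∃ C : ℝ, ∀ (Ω : Set (EuclideanSpace ℝ (Fin (m + 2))))
      (u : EuclideanSpace ℝ (Fin (m + 2)) → ℝ) (f : (Fin m → ℝ) → ℝ → ℝ),
      IsOpen Ω → Bornology.IsBounded Ω →
      ContDiffOn ℝ 4 u Ω → ContinuousOn u (closure Ω) → ConvexOn ℝ Ω u →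
      LevelSetEstimate.IncreasingInLast Ω u →
      (∀ x ∈ frontier Ω, u x = σ * x (Fin.last (m + 1))) →
      (∀ x ∈ Ω, 0 < f (LevelSetEstimate.middle x) (u x)) →
      (∀ x ∈ Ω, LevelSetEstimate.partialDeriv (Fin.last (m + 1)) u x ^ α
          * (LevelSetEstimate.hessian u x).det = f (LevelSetEstimate.middle x) (u x)) →
      (∀ x ∈ Ω, LevelSetEstimate.partialDeriv (Fin.last (m + 1)) u x ≤ M₁) →
      (∀ x ∈ Ω, |LevelSetEstimate.partialDeriv 0 (LevelSetEstimate.levelGraph Ω u)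
          (LevelSetEstimate.setLast x (u x))| ≤ M₂) →
      ∀ x ∈ Ω,
        ContDiffAt ℝ 4 (LevelSetEstimate.levelGraph Ω u) (LevelSetEstimate.setLast x (u x)) ∧
        LevelSetEstimate.partialDeriv 0
            (LevelSetEstimate.partialDeriv 0 (LevelSetEstimate.levelGraph Ω u))
            (LevelSetEstimate.setLast x (u x)) * |u x - σ * x (Fin.last (m + 1))| ≤ C :=
  theorem5p2_general m α σ (by linarith) M₁ M₂
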